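/- **Setting.** A *game* $G=(V,E,w)$ is a finite directed graph (possibly empty) in which every vertex has an outgoing edge, with $w:E\to\mathbb Z$ and a partition $V=V_{\mathrm{Min}}\uplus V_{\mathrm{Max}}$. A *strategy* of a player chooses one outgoing edge for each of her vertices. The value of a vertex $v$ is $\inf_\sigma\sup_{\pi\models\sigma}\mathrm{MP}(\pi)$, or equally $\sup_\tau\inf_{\pi\models\tau}\mathrm{MP}(\pi)$, where $\sigma,\tau$ range over strategies of Min and Max, $\pi$ over the consistent infinite paths from $v$, and $\mathrm{MP}(v_0\xrightarrow{w_0}v_1\xrightarrow{w_1}\cdots)=\limsup_k\frac1k\sum_{i<k}w_i$. For $S\subseteq V$, $G\setminus S$ denotes the game induced on $V\setminus S$. $N$ (resp. $P$) is the set of vertices such that the player owning the vertex, Min minimising and Max maximising the weight of the next edge, obtains a weight $<0$ (resp. $>0$). $ZN$ (resp. $ZP$) is the set of vertices from which Min (resp. Max) can force to see an edge of weight $<0$ (resp. $>0$) before any edge of weight $>0$ (resp. $<0$). A vertex of $ZN$ (resp. $ZP$) is *reduced* if Min (resp. Max) can force that the next edge has weight $\le 0$ (resp. $\ge 0$) and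 leads to $ZN$ (resp. $ZP$); $G$ is *reduced* if all its vertices are. For $\phi:V\to\mathbb Z$, $G_\phi$ is the game with weights $w_\phi(vv')=w(vv')+\phi(v')-\phi(v)$; $\phi$ is a *reducing potential* if $G_\phi$ is reduced. **Procedure** $\mathrm{ReduceGame}(G)$. 1. Compute $N$ and $P$, then $ZN$ by backtracking: starting from $U=N$, repeatedly add to $U$ a vertex of $V\setminus(P\cup U)$ that is a Min-vertex with a $0$-edge to $U$, or a Max-vertex all of whose $0$-edges lead to $U$. Put $ZN=U$, $ZP=V\setminus U$. If all vertices are reduced, return $(ZN,ZP,0)$. 2. If $|N|\le|P|$, proceed as below; otherwise proceed symmetrically (on the dual game, in which the players are exchanged and the weights negated; recursive calls are still made on the corresponding primal games). Put $F=N$ and $s(v)=0$ for all $v$. 3. As long as some $v\notin F$ has all its edges towards $F$, set $s(v)$ to the minimum (if $v\in V_{\mathrm{Min}}$) or maximum (if $v\in V_{\mathrm{Max}}$) of $w(vv')+s(v')$ over the edges $vv'$, and add $v$ to $F$. 4. Let $H=G\setminus F$ and $(H^-,H^+,\phi_H)=\mathrm{ReduceGame}(H)$. - (a) If $H^+\ne\varnothing$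 and there is an edge from $H^+\cap V_{\mathrm{Min}}$ to $F$: take such an edge $vv'$ minimising $w(vv')+s(v')-\phi_H(v)$, set $s(v)=w(vv')+s(v')$, add $v$ to $F$, go to 3. - (b) If $H^+\ne\varnothing$ and there is no such edge: let $A=H^+$, $\phi_A=\phi_H$. As long as possible, take $v\notin A$ that is either a Min-vertex with all its edges towards $A$, and set $\phi_A(v)=\min_{vv'\in E}(w(vv')+\phi_A(v'))$, or a Max-vertex with an edge $vv'$ to $A$, and set $\phi_A(v)=w(vv')+\phi_A(v')$ for some such edge; add $v$ to $A$. Then let $(G'^-,G'^+,\phi')=\mathrm{ReduceGame}(G\setminus A)$ and $\delta=-\min w(vv')-\min_{A}\phi_A+\max_{V\setminus A}\phi'$, the first minimum being over the edges from $V\setminus A$ to $A$ ($\delta$ is arbitrary if there is none). Return $(G'^-,\,G'^+\cup A,\,\phi)$, where $\phi$ is $\phi_A+\delta$ on $A$ and $\phi'$ on $V\setminus A$. - (c) If $H^+=\varnothing\ne H^-$: take an edge $vv'$ from $H\cap V_{\mathrm{Max}}$ to $F$ maximising $w(vv')+s(v')-\phi_H(v)$, set $s(v)=w(vv')+s(v')$,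 add $v$ to $F$, go to 3. - (d) If $H=\varnothing$: let $(G^-,G^+,\phi')=\mathrm{ReduceGame}(G_s)$ and return $(G^-,G^+,\phi'+s)$. **Theorem.** Let $G$ be a game in which no simple cycle has weight zero. Then, however the free choices in the procedure are made, $\mathrm{ReduceGame}(G)$ terminates, never gets stuck (every required edge exists, and every recursive call is on a game), and returns a triple $(G^-,G^+,\phi)$ such that $\phi$ is a reducing potential for $G$, $G^-=ZN_{G_\phi}$ and $G^+=ZP_{G_\phi}$. Moreover it solves the mean-payoff threshold problem: $G^-$ is the set of vertices of value $\le 0$, $G^+$ is the set of vertices of value $>0$, and no vertex has value $0$ (for both of the above expressions of the value). -/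

import Mathlib

/-- A mean-payoff game whose vertices are taken from an ambient type `V`: a finite sinkless
directed graph with integer edge weights. A vertex is a Min-vertex if it lies in `minOwned`,
and a Max-vertex otherwise. Only the values of `w` on edges matter. -/
structure Game (V : Type*) where
  verts : Set V
  minOwned : Set V
  E : V → V → Prop
  w : V → V → ℤ
  finite : verts.Finite
  edge_mem : ∀ u v, E u v → u ∈ verts ∧ v ∈ verts
  sinkless : ∀ v ∈ verts, ∃ v', E v v'

namespace Game

variable {V : Type*}

/-- The Min-vertices. -/
def minVerts (G : Game V) : Set V := G.verts ∩ G.minOwned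

/-- The Max-vertices. -/
def maxVerts (G : Game V) : Set V := G.verts \ G.minOwned

/-- No simple cycle `c 0 → c 1 → ⋯ → c n = c 0` has weight zero. -/
def NoZeroCycle (G : Game V) : Prop :=
  ∀ (n : ℕ) (c : ℕ → V), 0 < n → Set.InjOn c (Set.Iio n) → c n = c 0 →
    (∀ i < n, G.E (c i) (c (i + 1))) → ∑ i ∈ Finset.range n, G.w (c i) (c (i + 1)) ≠ 0

/-! ### Operations on games -/

/-- The subgame induced on the set of vertices `S`, provided that it is sinkless. -/
def restrict (G : Game V) (S : Set V) (hS : S ⊆ G.verts)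
    (h : ∀ v ∈ S, ∃ v' ∈ S, G.E v v') : Game V where
  verts := S
  minOwned := G.minOwned
  E u v := G.E u v ∧ u ∈ S ∧ v ∈ S
  w := G.w
  finite := G.finite.subset hS
  edge_mem _ _ e := e.2
  sinkless v hv := by
    obtain ⟨v', hv', e⟩ := h v hv
    exact ⟨v', e, hv, hv'⟩

/-- The game obtained by a potential reduction: `w_φ(vv') = w(vv') + φ(v') - φ(v)`. -/
def reduce (G : Game V) (φ : V → ℤ) : Game V :=
  { G with w := fun v v' => G.w v v' + φ v' - φ v }

/-- The dual game: the roles of the players are exchanged and the weights are negated. -/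
def dual (G : Game V) : Game V :=
  { G with minOwned := G.minOwnedᶜ, w := fun v v' => - G.w v v' }

/-- `G` itself or its dual. -/
def orient : Bool → Game V → Game V
  | false, G => G
  | true, G => G.dual

/-! ### Strategies, paths, mean-payoff values -/

/-- A positional Min-strategy. -/
def IsMinStrategy (G : Game V) (σ : V → V) : Prop := ∀ v ∈ G.minVerts, G.E v (σ v)

/-- A positional Max-strategy. -/
def IsMaxStrategy (G : Game V) (τ : V → V) : Prop := ∀ v ∈ G.maxVerts, G.E v (τ v)

/-- `π` is an infinite path of `G` starting from `v`. -/
def IsPathFrom (G : Game V) (v : V) (π : ℕ → V) : Prop :=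
  π 0 = v ∧ ∀ i, G.E (π i) (π (i + 1))

/-- The infinite paths from `v` that are consistent with the Min-strategy `σ`. -/
def minConsistent (G : Game V) (σ : V → V) (v : V) : Set (ℕ → V) :=
  {π | G.IsPathFrom v π ∧ ∀ i, π i ∈ G.minVerts → π (i + 1) = σ (π i)}

/-- The infinite paths from `v` that are consistent with the Max-strategy `τ`. -/
def maxConsistent (G : Game V) (τ : V → V) (v : V) : Set (ℕ → V) :=
  {π | G.IsPathFrom v π ∧ ∀ i, π i ∈ G.maxVerts → π (i + 1) = τ (π i)}

/-- The mean-payoff valuation of an infinite path. -/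
noncomputable def MP (G : Game V) (π : ℕ → V) : EReal :=
  Filter.limsup (fun k : ℕ =>
    (((∑ i ∈ Finset.range k, (G.w (π i) (π (i + 1)) : ℝ)) / (k : ℝ) : ℝ) : EReal)) Filter.atTop

/-- The mean-payoff value of `v`, as `inf_σ sup_{π ⊨ σ} MP(π)`. -/
noncomputable def upperValue (G : Game V) (v : V) : EReal :=
  ⨅ σ ∈ {σ | G.IsMinStrategy σ}, ⨆ π ∈ G.minConsistent σ v, G.MP π

/-- The mean-payoff value of `v`, as `sup_τ inf_{π ⊨ τ} MP(π)`. -/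
noncomputable def lowerValue (G : Game V) (v : V) : EReal :=
  ⨆ τ ∈ {τ | G.IsMaxStrategy τ}, ⨅ π ∈ G.maxConsistent τ v, G.MP π

/-- `(lo, hi)` solves the mean-payoff threshold problem: `lo` holds the vertices of value `≤ 0`,
and `hi` those of value `> 0`; moreover no vertex has value zero. This is required for both
expressions of the value. -/
def IsWinningRegions (G : Game V) (lo hi : Set V) : Prop :=
  ∀ val ∈ ({G.upperValue, G.lowerValue} : Set (V → EReal)),
    lo = {v ∈ G.verts | val v ≤ 0} ∧ hi = {v ∈ G.verts | 0 < val v} ∧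
      ∀ v ∈ G.verts, val v ≠ 0

/-! ### Zones and reduced games -/

/-- The vertices whose immediately optimal edges have weight `< 0`. -/
def N (G : Game V) : Set V :=
  {v ∈ G.minVerts | ∃ v', G.E v v' ∧ G.w v v' < 0} ∪
    {v ∈ G.maxVerts | ∀ v', G.E v v' → G.w v v' < 0}

/-- The vertices whose immediately optimal edges have weight `> 0`. -/
def P (G : Game V) : Set V :=
  {v ∈ G.minVerts | ∀ v', G.E v v' → 0 < G.w v v'} ∪
    {v ∈ G.maxVerts | ∃ v', G.E v v' ∧ 0 < G.w v v'}

/-- The vertices from which Min can force to see a `< 0` edge before any `> 0` edge. -/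
def ZN (G : Game V) : Set V :=
  {v ∈ G.verts | ∃ σ, G.IsMinStrategy σ ∧ ∀ π ∈ G.minConsistent σ v,
    ∃ k, G.w (π k) (π (k + 1)) < 0 ∧ ∀ i < k, G.w (π i) (π (i + 1)) ≤ 0}

/-- The vertices from which Max can force to see a `> 0` edge before any `< 0` edge. -/
def ZP (G : Game V) : Set V :=
  {v ∈ G.verts | ∃ τ, G.IsMaxStrategy τ ∧ ∀ π ∈ G.maxConsistent τ v,
    ∃ k, 0 < G.w (π k) (π (k + 1)) ∧ ∀ i < k, 0 ≤ G.w (π i) (π (i + 1))}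

/-- Min can force that the first edge seen from `v` has weight `≤ 0` and leads to `ZN`. -/
def NegReducedAt (G : Game V) (v : V) : Prop :=
  (v ∈ G.minVerts → ∃ v', G.E v v' ∧ G.w v v' ≤ 0 ∧ v' ∈ G.ZN) ∧
    (v ∈ G.maxVerts → ∀ v', G.E v v' → G.w v v' ≤ 0 ∧ v' ∈ G.ZN)

/-- Max can force that the first edge seen from `v` has weight `≥ 0` and leads to `ZP`. -/
def PosReducedAt (G : Game V) (v : V) : Prop :=
  (v ∈ G.maxVerts → ∃ v', G.E v v' ∧ 0 ≤ G.w v v' ∧ v' ∈ G.ZP) ∧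
    (v ∈ G.minVerts → ∀ v', G.E v v' → 0 ≤ G.w v v' ∧ v' ∈ G.ZP)

/-- All vertices are reduced. -/
def IsReduced (G : Game V) : Prop :=
  (∀ v ∈ G.ZN, G.NegReducedAt v) ∧ (∀ v ∈ G.ZP, G.PosReducedAt v)

/-- `φ` is a reducing potential for `G`. -/
def IsReducingPotential (G : Game V) (φ : V → ℤ) : Prop := (G.reduce φ).IsReduced

end Game

/-! ### The procedure `ReduceGame`

It is given by an abstract machine with an explicit call stack. The choices which the procedure
leaves open (`take some v`, `let vv' be such an edge`) make the machine nondeterministic. -/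

namespace ReduceGame

variable {V : Type*}

/-- The triple `(G⁻, G⁺, φ)` that is returned. -/
structure Output (V : Type*) where
  lo : Set V
  hi : Set V
  pot : V → ℤ

/-- What an output for a game means for the dual game. -/
def Output.dual (o : Output V) : Output V := ⟨o.hi, o.lo, fun v => - o.pot v⟩

/-- `o` itself or its dual. -/
def Output.orient : Bool → Output V → Output V
  | false, o => o
  | true, o => o.dual

open Classical in
/-- The assignment `φ(v) ← x`. -/
noncomputable def assign (φ : V → ℤ) (v : V) (x : ℤ) : V → ℤ := fun u => if u = v then x else φ u

open Classical in
/-- The potential `(φA + δ) ⊎ φ'`, where `φA` is a potential over `A`. -/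
noncomputable def glue (A : Set V) (φA : V → ℤ) (δ : ℤ) (φ' : V → ℤ) : V → ℤ :=
  fun u => if u ∈ A then φA u + δ else φ' u

/-- Backtracking for the zones: `v` has to be added to the part `U` of `ZN` found so far. -/
def ZoneAddable (G : Game V) (U : Set V) (v : V) : Prop :=
  v ∉ G.P ∪ U ∧
    ((v ∈ G.minVerts ∧ ∃ v', G.E v v' ∧ G.w v v' = 0 ∧ v' ∈ U) ∨
      (v ∈ G.maxVerts ∧ ∀ v', G.E v v' → G.w v v' = 0 → v' ∈ U))

/-- The test whether all vertices of `G` are reduced, given the computed zones `U = ZN` and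
`G.verts \ U = ZP`. -/
def ReducedTest (G : Game V) (U : Set V) : Prop :=
  (∀ v ∈ G.minVerts ∩ U, ∃ v', G.E v v' ∧ v' ∈ U ∧ G.w v v' ≤ 0) ∧
  (∀ v ∈ G.maxVerts ∩ U, ∀ v', G.E v v' → v' ∈ U ∧ G.w v v' ≤ 0) ∧
  (∀ v ∈ G.maxVerts \ U, ∃ v', G.E v v' ∧ v' ∈ G.verts \ U ∧ 0 ≤ G.w v v') ∧
  (∀ v ∈ G.minVerts \ U, ∀ v', G.E v v' → v' ∈ G.verts \ U ∧ 0 ≤ G.w v v')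

/-- The vertex `v` outside `F` has all its edges towards `F`. -/
def AllEdgesTo (G : Game V) (F : Set V) (v : V) : Prop :=
  v ∈ G.verts \ F ∧ ∀ v', G.E v v' → v' ∈ F

/-- The set of all `w(vv') + φ(v')`, where `vv'` ranges over the edges from `v`. -/
def outSums (G : Game V) (φ : V → ℤ) (v : V) : Set ℤ :=
  {x | ∃ v', G.E v v' ∧ x = G.w v v' + φ v'}

/-- The vertex `v` outside `A` has to be added to `A` when backtracking for Max. -/
def MaxAttracted (G : Game V) (A : Set V) (v : V) : Prop :=
  v ∈ G.verts \ A ∧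
    ((v ∈ G.minVerts ∧ ∀ v', G.E v v' → v' ∈ A) ∨ (v ∈ G.maxVerts ∧ ∃ v' ∈ A, G.E v v'))

/-- `vv'` is an edge from the set `X` to the set `F`. -/
def EdgeFromTo (G : Game V) (X F : Set V) (v v' : V) : Prop := G.E v v' ∧ v ∈ X ∧ v' ∈ F

/-- The value of `δ` with which potentials over `A` and over `G \ A` are glued:
`δ = - min w(vv') - min φA(v') + max φ'(v)`, where `v` and `v'` range over `G \ A` and `A`.
If there is no edge from `G \ A` to `A`, then the first minimum does not make sense, and any `δ`
may be taken. -/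
def GluingConstant (G : Game V) (A : Set V) (φA φ' : V → ℤ) (δ : ℤ) : Prop :=
  (∃ v v', EdgeFromTo G (G.verts \ A) A v v') →
    ∃ a b c : ℤ,
      IsLeast {x | ∃ v v', EdgeFromTo G (G.verts \ A) A v v' ∧ x = G.w v v'} a ∧
      IsLeast (φA '' A) b ∧ IsGreatest (φ' '' (G.verts \ A)) c ∧ δ = - a - b + c

/-- Activations of the procedure that wait for the result of a recursive call. In each of them,
`D` is the game of the activation if the flag is `false` (the case `|N| ≤ |P|`), and its dual if
the flag is `true` (the symmetric case). -/
inductive Frame (V : Type*)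
  /-- waits for the result on `H = D \ F`; `φ` holds the values found so far -/
  | sub (b : Bool) (D : Game V) (F : Set V) (φ : V → ℤ)
  /-- waits for the result on `D \ A` -/
  | rest (b : Bool) (D : Game V) (A : Set V) (φA : V → ℤ)
  /-- waits for the result on the potential reduction of `D` by `φ` -/
  | shift (b : Bool) (φ : V → ℤ)

/-- The states of the machine; flags and games `D` are as for frames. -/
inductive State (V : Type*)
  /-- `ReduceGame` is called on `G` -/
  | call (G : Game V) (k : List (Frame V))
  /-- computation of the zones of `G`: `U` is the part of `ZN` found so far -/
  | zones (G : Game V) (U : Set V) (k : List (Frame V))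
  /-- start of the body of the while loop, where all-paths backtracking takes place -/
  | loop (b : Bool) (D : Game V) (F : Set V) (φ : V → ℤ) (k : List (Frame V))
  /-- backtracking for Max from a set of vertices on which `D` has been solved -/
  | attract (b : Bool) (D : Game V) (A : Set V) (φA : V → ℤ) (k : List (Frame V))
  /-- a call returns `o` -/
  | ret (o : Output V) (k : List (Frame V))

/-- One step of the machine. -/
inductive Step : State V → State V → Prop
  | start (G : Game V) (k : List (Frame V)) : Step (.call G k) (.zones G G.N k)
  | zone_add (G : Game V) (U : Set V) (k : List (Frame V)) (v : V) (hv : ZoneAddable G U v) :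
      Step (.zones G U k) (.zones G (insert v U) k)
  | reduced (G : Game V) (U : Set V) (k : List (Frame V)) (hU : ¬ ∃ v, ZoneAddable G U v)
      (h : ReducedTest G U) :
      Step (.zones G U k) (.ret ⟨U, G.verts \ U, fun _ => 0⟩ k)
  | choose_N (G : Game V) (U : Set V) (k : List (Frame V)) (hU : ¬ ∃ v, ZoneAddable G U v)
      (h : ¬ ReducedTest G U) (hle : G.N.ncard ≤ G.P.ncard) :
      Step (.zones G U k) (.loop false G G.N (fun _ => 0) k)
  | choose_P (G : Game V) (U : Set V) (k : List (Frame V)) (hU : ¬ ∃ v, ZoneAddable G U v)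
      (h : ¬ ReducedTest G U) (hlt : G.P.ncard < G.N.ncard) :
      Step (.zones G U k) (.loop true G.dual G.dual.N (fun _ => 0) k)
  | backtrack_min (b : Bool) (D : Game V) (F : Set V) (φ : V → ℤ) (k : List (Frame V))
      (v : V) (x : ℤ) (hv : AllEdgesTo D F v) (hmin : v ∈ D.minVerts)
      (hx : IsLeast (outSums D φ v) x) :
      Step (.loop b D F φ k) (.loop b D (insert v F) (assign φ v x) k)
  | backtrack_max (b : Bool) (D : Game V) (F : Set V) (φ : V → ℤ) (k : List (Frame V))
      (v : V) (x : ℤ) (hv : AllEdgesTo D F v) (hmax : v ∈ D.maxVerts)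
      (hx : IsGreatest (outSums D φ v) x) :
      Step (.loop b D F φ k) (.loop b D (insert v F) (assign φ v x) k)
  | recurse_sub (b : Bool) (D : Game V) (F : Set V) (φ : V → ℤ) (k : List (Frame V))
      (hF : ¬ ∃ v, AllEdgesTo D F v)
      (hH : ∀ v ∈ D.verts \ F, ∃ v' ∈ D.verts \ F, D.E v v') :
      Step (.loop b D F φ k)
        (.call ((D.restrict (D.verts \ F) Set.sdiff_subset hH).orient b) (.sub b D F φ :: k))
  /- the region `H⁺` is non-empty and Min can escape from it -/
  | escape_min (b : Bool) (D : Game V) (F : Set V) (φ : V → ℤ) (k : List (Frame V))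
      (o oH : Output V) (v v' : V) (ho : oH = o.orient b) (hne : oH.hi.Nonempty)
      (he : EdgeFromTo D (oH.hi ∩ D.minVerts) F v v')
      (hopt : ∀ u u', EdgeFromTo D (oH.hi ∩ D.minVerts) F u u' →
        D.w v v' + φ v' - oH.pot v ≤ D.w u u' + φ u' - oH.pot u) :
      Step (.ret o (.sub b D F φ :: k))
        (.loop b D (insert v F) (assign φ v (D.w v v' + φ v')) k)
  /- the region `H⁺` is non-empty and Min cannot escape from it -/
  | no_escape (b : Bool) (D : Game V) (F : Set V) (φ : V → ℤ) (k : List (Frame V))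
      (o oH : Output V) (ho : oH = o.orient b) (hne : oH.hi.Nonempty)
      (hno : ¬ ∃ v v', EdgeFromTo D (oH.hi ∩ D.minVerts) F v v') :
      Step (.ret o (.sub b D F φ :: k)) (.attract b D oH.hi oH.pot k)
  /- the region `H⁺` is empty and `H⁻` is not -/
  | escape_max (b : Bool) (D : Game V) (F : Set V) (φ : V → ℤ) (k : List (Frame V))
      (o oH : Output V) (v v' : V) (ho : oH = o.orient b) (hempty : oH.hi = ∅)
      (hne : oH.lo.Nonempty)
      (he : EdgeFromTo D ((D.verts \ F) ∩ D.maxVerts) F v v')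
      (hopt : ∀ u u', EdgeFromTo D ((D.verts \ F) ∩ D.maxVerts) F u u' →
        D.w u u' + φ u' - oH.pot u ≤ D.w v v' + φ v' - oH.pot v) :
      Step (.ret o (.sub b D F φ :: k))
        (.loop b D (insert v F) (assign φ v (D.w v v' + φ v')) k)
  /- both regions are empty: recursive call on the potential reduction by `φ` -/
  | recurse_shift (b : Bool) (D : Game V) (F : Set V) (φ : V → ℤ) (k : List (Frame V))
      (o oH : Output V) (ho : oH = o.orient b) (hhi : oH.hi = ∅) (hlo : oH.lo = ∅) :
      Step (.ret o (.sub b D F φ :: k)) (.call ((D.reduce φ).orient b) (.shift b φ :: k))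
  | return_shift (b : Bool) (φ : V → ℤ) (k : List (Frame V))
      (o o' : Output V) (ho : o' = o.orient b) :
      Step (.ret o (.shift b φ :: k))
        (.ret (Output.orient b ⟨o'.lo, o'.hi, fun v => o'.pot v + φ v⟩) k)
  | attract_min (b : Bool) (D : Game V) (A : Set V) (φA : V → ℤ) (k : List (Frame V))
      (v : V) (x : ℤ) (hv : MaxAttracted D A v) (hmin : v ∈ D.minVerts)
      (hx : IsLeast (outSums D φA v) x) :
      Step (.attract b D A φA k) (.attract b D (insert v A) (assign φA v x) k)
  | attract_max (b : Bool) (D : Game V) (A : Set V) (φA : V → ℤ) (k : List (Frame V))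
      (v v' : V) (hv : MaxAttracted D A v) (hmax : v ∈ D.maxVerts)
      (he : D.E v v') (hv' : v' ∈ A) :
      Step (.attract b D A φA k)
        (.attract b D (insert v A) (assign φA v (D.w v v' + φA v')) k)
  | recurse_rest (b : Bool) (D : Game V) (A : Set V) (φA : V → ℤ) (k : List (Frame V))
      (hA : ¬ ∃ v, MaxAttracted D A v)
      (hG' : ∀ v ∈ D.verts \ A, ∃ v' ∈ D.verts \ A, D.E v v') :
      Step (.attract b D A φA k)
        (.call ((D.restrict (D.verts \ A) Set.sdiff_subset hG').orient b) (.rest b D A φA :: k))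
  | return_rest (b : Bool) (D : Game V) (A : Set V) (φA : V → ℤ) (k : List (Frame V))
      (o o' : Output V) (δ : ℤ) (ho : o' = o.orient b) (hδ : GluingConstant D A φA o'.pot δ) :
      Step (.ret o (.rest b D A φA :: k))
        (.ret (Output.orient b ⟨o'.lo, o'.hi ∪ A, glue A φA δ o'.pot⟩) k)

/-- The state `s` occurs in some execution of `ReduceGame` on `G`. -/
def Reachable (G : Game V) (s : State V) : Prop :=
  Relation.ReflTransGen Step (State.call G []) s

end ReduceGame

/-!
The correctness of an output is a matter of certificates. Call a set `A` of vertices a trap of Max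
for a potential `φ` if from `A` she can stay in `A` and see only edges whose weight, reduced by `φ`,
is `≥ 0` (`Game.MaxTrap`). As no simple cycle has weight zero, a play in the trap sees a positive
reduced weight at least once in every `|V|` steps. Hence the trap lies in the zone `ZP` of the
reduced game, and its vertices have positive value. If the set of vertices is partitioned into a
trap of Min and a trap of Max for the same potential (`ReduceGame.Solves`), then these traps are the two
zones and the two winning regions. The test for reducedness checks that the zero potential is such
a certificate, and each way of combining the results of recursive calls yields one again
(`Solves.reduce`, `Solves.glue`), whatever the free choices were.

Termination needs more. Recursive calls on proper subgames have fewer vertices. In a recursive call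
on the potential reduction of `G` by `s`, the smaller one of `|N|` and `|P|` decreases: it is shown
that the vertices outside `N` have optimal edges of weight zero in the reduced game, so that the new
`N` and `P` are disjoint subsets of the old `N`, which was the smaller one of the two sets. To this
end, consider the game that is stopped with payoff zero at `N`. Its subsolutions are the potentials
that vanish on `N` and at any other vertex do not exceed the optimal `w(vv') + t(v')`. The invariant
of the while loop (`LoopInv`) says that on the set `F` of processed vertices, `s` is the greatest
subsolution. The choices of escape edges preserve it: the potential of the subgame `H`, shifted by a
constant, is a subsolution on `H⁺` (`LoopInv.escape_min`), and, if `H⁺` is empty, an upper bound of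
all subsolutions on `H`, since otherwise a cycle of weight zero would exist (`LoopInv.escape_max`).
Were a vertex outside `N` in the new `P`, then `s` could be increased there (`LoopInv.N_P_subset`).

That nothing goes wrong is expressed by the inductive predicate `Succeeds` on the states of the
machine. A call succeeds for every stack for which the return of any solution succeeds
(`succeeds_call`); this is proved by induction on the rank of the game.
-/

namespace Game

variable {V : Type*}

/-! ### Duality -/

theorem dual_dual (G : Game V) : G.dual.dual = G := by
  cases G; simp [dual]

theorem minVerts_dual (G : Game V) : G.dual.minVerts = G.maxVerts := rfl

theorem maxVerts_dual (G : Game V) : G.dual.maxVerts = G.minVerts := by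
  ext v; simp [minVerts, maxVerts, dual]

theorem mem_minVerts_or_mem_maxVerts (G : Game V) {v : V} (hv : v ∈ G.verts) :
    v ∈ G.minVerts ∨ v ∈ G.maxVerts := by
  by_cases h : v ∈ G.minOwned
  · exact Or.inl ⟨hv, h⟩
  · exact Or.inr ⟨hv, h⟩

theorem disjoint_minVerts_maxVerts (G : Game V) : Disjoint G.minVerts G.maxVerts :=
  Set.disjoint_left.2 fun _ h h' => h'.2 h.2

theorem N_dual (G : Game V) : G.dual.N = G.P := by
  unfold N P
  rw [minVerts_dual, maxVerts_dual, Set.union_comm]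
  simp [dual]

theorem P_dual (G : Game V) : G.dual.P = G.N := by
  rw [← N_dual, dual_dual]

theorem N_subset (G : Game V) : G.N ⊆ G.verts := by
  rintro v (h | h)
  · exact h.1.1
  · exact h.1.1

theorem P_subset (G : Game V) : G.P ⊆ G.verts := by
  rw [← N_dual]; exact G.dual.N_subset

theorem disjoint_N_P (G : Game V) : Disjoint G.N G.P := by
  refine Set.disjoint_left.2 ?_
  rintro v (⟨hv, v', e, h⟩ | ⟨hv, h⟩) (⟨hv', h'⟩ | ⟨hv', h'⟩)
  · exact absurd (h' v' e) (by omega)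
  · exact hv'.2 hv.2
  · exact hv.2 hv'.2
  · obtain ⟨v', e, h'⟩ := h'
    exact absurd (h v' e) (by omega)

theorem maxConsistent_dual (G : Game V) (σ : V → V) (v : V) :
    G.dual.maxConsistent σ v = G.minConsistent σ v := by
  simp only [maxConsistent, minConsistent, maxVerts_dual]; rfl

theorem isMaxStrategy_dual (G : Game V) (σ : V → V) :
    G.dual.IsMaxStrategy σ ↔ G.IsMinStrategy σ := by
  simp only [IsMaxStrategy, IsMinStrategy, maxVerts_dual]; rfl

theorem ZP_dual (G : Game V) : G.dual.ZP = G.ZN := by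
  ext v
  simp only [ZP, ZN, isMaxStrategy_dual, maxConsistent_dual, Set.mem_ofPred_eq]
  simp [dual]

theorem NoZeroCycle.dual {G : Game V} (hG : G.NoZeroCycle) : G.dual.NoZeroCycle := by
  intro n c hn hc hcn hE
  simpa [Game.dual] using hG n c hn hc hcn hE

theorem NoZeroCycle.orient {G : Game V} (hG : G.NoZeroCycle) (b : Bool) :
    (orient b G).NoZeroCycle := by
  cases b
  · exact hG
  · exact hG.dual

theorem NoZeroCycle.restrict {G : Game V} (hG : G.NoZeroCycle) {S : Set V} (hS : S ⊆ G.verts)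
    (h : ∀ v ∈ S, ∃ v' ∈ S, G.E v v') : (G.restrict S hS h).NoZeroCycle :=
  fun n c hn hc hcn hE => hG n c hn hc hcn fun i hi => (hE i hi).1

/-- Potentials telescope along a path. -/
theorem sum_reduce (G : Game V) (φ : V → ℤ) (π : ℕ → V) (n : ℕ) :
    ∑ i ∈ Finset.range n, (G.reduce φ).w (π i) (π (i + 1)) =
      ∑ i ∈ Finset.range n, G.w (π i) (π (i + 1)) + φ (π n) - φ (π 0) := by
  induction n with
  | zero => simp
  | succ n ih =>
    rw [Finset.sum_range_succ, ih, Finset.sum_range_succ]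
    simp only [reduce]; ring

theorem NoZeroCycle.reduce {G : Game V} (hG : G.NoZeroCycle) (φ : V → ℤ) :
    (G.reduce φ).NoZeroCycle := by
  intro n c hn hc hcn hE
  rw [sum_reduce, hcn]
  simpa using hG n c hn hc hcn hE

/-! ### Paths of weight zero -/

theorem IsPathFrom.mem_verts {G : Game V} {v : V} {π : ℕ → V} (h : G.IsPathFrom v π) (i : ℕ) :
    π i ∈ G.verts := (G.edge_mem _ _ (h.2 i)).1

/-- By the pigeonhole principle, a path with as many zero edges as there are vertices contains a
simple cycle of weight zero. -/
theorem NoZeroCycle.exists_ne_zero {G : Game V} (hG : G.NoZeroCycle) {π : ℕ → V}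
    (hπ : ∀ i, G.E (π i) (π (i + 1))) :
    ∃ i < G.verts.ncard, G.w (π i) (π (i + 1)) ≠ 0 := by
  classical
  by_contra! h0
  have hmem : ∀ i, π i ∈ G.verts := fun i => (G.edge_mem _ _ (hπ i)).1
  have hrep : ∃ j, j ≤ G.verts.ncard ∧ ∃ i < j, π i = π j := by
    obtain ⟨a, ha, b, hb, hab, heq⟩ := Finset.exists_ne_map_eq_of_card_lt_of_maps_to
      (s := Finset.range (G.verts.ncard + 1)) (t := G.finite.toFinset) (f := π)
      (by rw [Finset.card_range, Set.ncard_eq_toFinset_card _ G.finite]; omega)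
      (fun i _ => by simpa using hmem i)
    rw [Finset.mem_range] at ha hb
    rcases lt_or_gt_of_ne hab with h | h
    · exact ⟨b, by omega, a, h, heq⟩
    · exact ⟨a, by omega, b, h, heq.symm⟩
  -- the first repetition closes a simple cycle
  obtain ⟨hj, i, hij, heq⟩ := Nat.find_spec hrep
  have hmin : ∀ m < Nat.find hrep, ∀ l < m, π l ≠ π m := fun m hm l hl e =>
    Nat.find_min hrep hm ⟨by omega, l, hl, e⟩
  set j := Nat.find hrep
  refine hG (j - i) (fun t => π (i + t)) (by omega) ?_ ?_ (fun t _ => hπ (i + t)) ?_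
  · intro a ha b hb hab
    simp only [Set.mem_Iio] at ha hb
    by_contra hne
    rcases lt_or_gt_of_ne hne with h | h
    · exact hmin (i + b) (by omega) (i + a) (by omega) hab
    · exact hmin (i + a) (by omega) (i + b) (by omega) hab.symm
  · simp only [add_zero, heq]
    congr 1; omega
  · refine Finset.sum_eq_zero fun t ht => ?_
    rw [Finset.mem_range] at ht
    exact h0 (i + t) (by omega)

/-- A nonempty set of vertices in which zero edges can be followed forever contains a simple cycle
of weight zero. -/
theorem NoZeroCycle.eq_empty_of_forall_exists_zero {G : Game V} (hG : G.NoZeroCycle) {S : Set V}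
    (h : ∀ v ∈ S, ∃ v' ∈ S, G.E v v' ∧ G.w v v' = 0) : S = ∅ := by
  rw [Set.eq_empty_iff_forall_notMem]
  intro v hv
  choose! f hfS hfE hf0 using h
  have hS : ∀ i, f^[i] v ∈ S := by
    intro i
    induction i with
    | zero => exact hv
    | succ i ih => rw [Function.iterate_succ_apply']; exact hfS _ ih
  obtain ⟨i, -, hi⟩ := hG.exists_ne_zero (π := fun i => f^[i] v) (fun i => by
    rw [Function.iterate_succ_apply']; exact hfE _ (hS i))
  rw [Function.iterate_succ_apply'] at hi
  exact hi (hf0 _ (hS i))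

/-! ### Traps -/

/-- `A` is a set of vertices in which Max can stay forever while she sees only edges of weight
`≥ 0` with respect to the potential `φ`. Traps of Min are the `MaxTrap`s of the dual game. -/
structure MaxTrap (G : Game V) (A : Set V) (φ : V → ℤ) : Prop where
  subset : A ⊆ G.verts
  max : ∀ v ∈ A, v ∈ G.maxVerts → ∃ v' ∈ A, G.E v v' ∧ φ v ≤ G.w v v' + φ v'
  min : ∀ v ∈ A, v ∈ G.minVerts → ∀ v', G.E v v' → v' ∈ A ∧ φ v ≤ G.w v v' + φ v'

/-- A positional strategy of Max for staying in a trap. -/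
theorem MaxTrap.exists_strategy {G : Game V} {A : Set V} {φ : V → ℤ} (h : G.MaxTrap A φ) :
    ∃ τ, G.IsMaxStrategy τ ∧ ∀ v ∈ A, ∀ π ∈ G.maxConsistent τ v,
      ∀ i, 0 ≤ (G.reduce φ).w (π i) (π (i + 1)) := by
  have hex : ∀ v, ∃ v', (v ∈ G.verts → G.E v v') ∧
      (v ∈ A → v ∈ G.maxVerts → v' ∈ A ∧ φ v ≤ G.w v v' + φ v') := by
    intro v
    by_cases hv : v ∈ A ∧ v ∈ G.maxVerts
    · obtain ⟨v', hv', e, hle⟩ := h.max v hv.1 hv.2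
      exact ⟨v', fun _ => e, fun _ _ => ⟨hv', hle⟩⟩
    · by_cases hv' : v ∈ G.verts
      · obtain ⟨v', e⟩ := G.sinkless v hv'
        exact ⟨v', fun _ => e, fun h1 h2 => absurd ⟨h1, h2⟩ hv⟩
      · exact ⟨v, fun h => absurd h hv', fun h1 h2 => absurd ⟨h1, h2⟩ hv⟩
  choose τ hτE hτ using hex
  refine ⟨τ, fun v hv => hτE v hv.1, fun v hv π hπ => ?_⟩
  have key : ∀ i, π i ∈ A → π (i + 1) ∈ A ∧
      φ (π i) ≤ G.w (π i) (π (i + 1)) + φ (π (i + 1)) := by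
    intro i hi
    rcases G.mem_minVerts_or_mem_maxVerts (h.subset hi) with hm | hm
    · exact h.min _ hi hm _ (hπ.1.2 i)
    · rw [hπ.2 i hm]; exact hτ _ hi hm
  have hA : ∀ i, π i ∈ A := by
    intro i
    induction i with
    | zero => rw [hπ.1.1]; exact hv
    | succ i ih => exact (key i ih).1
  intro i
  have := (key i (hA i)).2
  simp only [reduce]; omega

theorem MaxTrap.subset_ZP {G : Game V} {A : Set V} {φ : V → ℤ} (h : G.MaxTrap A φ)
    (hG : G.NoZeroCycle) : A ⊆ (G.reduce φ).ZP := by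
  intro v hv
  obtain ⟨τ, hτ, hnn⟩ := h.exists_strategy
  refine ⟨h.subset hv, τ, hτ, fun π hπ => ?_⟩
  have hnn := hnn v hv π hπ
  obtain ⟨i, -, hi⟩ := (hG.reduce φ).exists_ne_zero (π := π) hπ.1.2
  exact ⟨i, lt_of_le_of_ne (hnn i) hi.symm, fun j _ => hnn j⟩

/-! ### Values -/

/-- The play determined by a strategy of each player. -/
theorem exists_mem_consistent (G : Game V) {σ τ : V → V} (hσ : G.IsMinStrategy σ)
    (hτ : G.IsMaxStrategy τ) {v : V} (hv : v ∈ G.verts) :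
    ∃ π, π ∈ G.minConsistent σ v ∧ π ∈ G.maxConsistent τ v := by
  classical
  let f : V → V := fun u => if u ∈ G.minOwned then σ u else τ u
  have hf : ∀ u ∈ G.verts, G.E u (f u) := by
    intro u hu
    by_cases h : u ∈ G.minOwned
    · simpa [f, h] using hσ u ⟨hu, h⟩
    · simpa [f, h] using hτ u ⟨hu, h⟩
  have hmem : ∀ i, f^[i] v ∈ G.verts := by
    intro i
    induction i with
    | zero => exact hv
    | succ i ih =>
      rw [Function.iterate_succ_apply']; exact (G.edge_mem _ _ (hf _ ih)).2
  have hpath : G.IsPathFrom v fun i => f^[i] v :=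
    ⟨rfl, fun i => by simpa only [Function.iterate_succ_apply'] using hf _ (hmem i)⟩
  refine ⟨fun i => f^[i] v, ⟨hpath, fun i hi => ?_⟩, ⟨hpath, fun i hi => ?_⟩⟩
  · simp only [Function.iterate_succ_apply']; exact if_pos hi.2
  · simp only [Function.iterate_succ_apply']; exact if_neg hi.2

theorem disjoint_ZN_ZP (G : Game V) : Disjoint G.ZN G.ZP := by
  refine Set.disjoint_left.2 ?_
  rintro v ⟨hv, σ, hσ, hN⟩ ⟨-, τ, hτ, hP⟩
  obtain ⟨π, h1, h2⟩ := G.exists_mem_consistent hσ hτ hv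
  obtain ⟨k, hk, hk'⟩ := hN π h1
  obtain ⟨l, hl, hl'⟩ := hP π h2
  rcases lt_trichotomy k l with h | rfl | h
  · exact absurd (hl' k h) (by omega)
  · omega
  · exact absurd (hk' l h) (by omega)

/-- Among as many consecutive edges as there are vertices, at least one has weight `≥ 1`. -/
theorem NoZeroCycle.div_le_sum {G : Game V} (hG : G.NoZeroCycle) {π : ℕ → V}
    (hπ : ∀ i, G.E (π i) (π (i + 1))) (hnn : ∀ i, 0 ≤ G.w (π i) (π (i + 1))) (k : ℕ) :
    ((k / G.verts.ncard : ℕ) : ℤ) ≤ ∑ i ∈ Finset.range k, G.w (π i) (π (i + 1)) := by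
  set n := G.verts.ncard
  have hmul : ∀ q : ℕ, (q : ℤ) ≤ ∑ i ∈ Finset.range (n * q), G.w (π i) (π (i + 1)) := by
    intro q
    induction q with
    | zero => simp
    | succ q ih =>
      rw [Nat.mul_succ, Finset.sum_range_add]
      obtain ⟨i, hi, hne⟩ := hG.exists_ne_zero (π := fun i => π (n * q + i))
        (fun i => hπ (n * q + i))
      have h1 : 1 ≤ G.w (π (n * q + i)) (π (n * q + i + 1)) :=
        lt_of_le_of_ne (hnn _) (Ne.symm hne)
      have h2 := Finset.single_le_sum (s := Finset.range n)
        (f := fun i => G.w (π (n * q + i)) (π (n * q + i + 1)))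
        (fun i _ => hnn _) (Finset.mem_range.2 hi)
      push_cast
      linarith
  refine (hmul _).trans (Finset.sum_le_sum_of_subset_of_nonneg ?_ fun i _ _ => hnn i)
  exact Finset.range_mono (Nat.mul_div_le k n)

/-- The average weights of a path that stays in a trap of Max are eventually bounded below by a
positive constant. -/
theorem MaxTrap.exists_eventually_le {G : Game V} {A : Set V} {φ : V → ℤ} (h : G.MaxTrap A φ)
    (hG : G.NoZeroCycle) {v : V} (hv : v ∈ A) :
    ∃ τ, G.IsMaxStrategy τ ∧ ∃ ε : ℝ, 0 < ε ∧ ∀ π ∈ G.maxConsistent τ v,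
      ∀ᶠ k : ℕ in Filter.atTop,
        ε ≤ (∑ i ∈ Finset.range k, (G.w (π i) (π (i + 1)) : ℝ)) / (k : ℝ) := by
  obtain ⟨τ, hτ, hnn⟩ := h.exists_strategy
  set n := G.verts.ncard with hn
  have hn0 : 0 < n := (Set.ncard_pos G.finite).2 ⟨v, h.subset hv⟩
  obtain ⟨B, hB⟩ : ∃ B, ∀ u ∈ G.verts, φ u ≤ B := by
    obtain ⟨B, hB⟩ := (G.finite.image φ).bddAbove
    exact ⟨B, fun u hu => hB ⟨u, hu, rfl⟩⟩
  have hn0' : (0 : ℝ) < n := by exact_mod_cast hn0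
  refine ⟨τ, hτ, 1 / (2 * n), by positivity, fun π hπ => ?_⟩
  -- the difference of the potentials and the rounding contribute at most `C` to the sums
  set C : ℝ := B - φ v + 1
  filter_upwards [Filter.eventually_gt_atTop 0, Filter.eventually_ge_atTop ⌈2 * n * C⌉₊]
    with k hk0 hkC
  have hk0' : (0 : ℝ) < k := by exact_mod_cast hk0
  have hkC' : 2 * n * C ≤ k := Nat.ceil_le.1 hkC
  have h1 := (hG.reduce φ).div_le_sum hπ.1.2 (hnn v hv π hπ) k
  rw [sum_reduce, hπ.1.1] at h1
  have h2 := hB _ (hπ.1.mem_verts k)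
  have h3 : ((k / n : ℕ) : ℤ) + φ v - B ≤ ∑ i ∈ Finset.range k, G.w (π i) (π (i + 1)) := by
    have : (G.reduce φ).verts.ncard = n := rfl
    rw [this] at h1; linarith
  have h5 : (k : ℝ) / n ≤ ((k / n : ℕ) : ℝ) + 1 := by
    rw [div_le_iff₀ hn0']
    have := Nat.lt_mul_div_succ k hn0
    have h' : k ≤ (k / n + 1) * n := by rw [mul_comm]; omega
    exact_mod_cast h'
  generalize k / n = q at h3 h5
  have h4 : (q : ℝ) + φ v - B ≤ ∑ i ∈ Finset.range k, (G.w (π i) (π (i + 1)) : ℝ) := by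
    exact_mod_cast h3
  rw [le_div_iff₀ hk0']
  have h6 : C ≤ k / (2 * n) := by
    rw [le_div_iff₀ (by positivity)]; linarith
  have h7 : (k : ℝ) / n = k / (2 * n) + k / (2 * n) := by field_simp; ring
  have h8 : 1 / (2 * (n : ℝ)) * k = k / (2 * n) := by ring
  rw [h8]
  simp only [C] at h6
  linarith

theorem pos_values_of_maxTrap {G : Game V} {A : Set V} {φ : V → ℤ} (h : G.MaxTrap A φ)
    (hG : G.NoZeroCycle) {v : V} (hv : v ∈ A) : 0 < G.upperValue v ∧ 0 < G.lowerValue v := by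
  obtain ⟨τ, hτ, ε, hε, hMP⟩ := h.exists_eventually_le hG hv
  have hMP' : ∀ π ∈ G.maxConsistent τ v, (ε : EReal) ≤ G.MP π := fun π hπ =>
    Filter.le_limsup_of_frequently_le
      ((hMP π hπ).mono fun k hk => EReal.coe_le_coe_iff.2 hk).frequently
  have hε' : (0 : EReal) < ε := by exact_mod_cast hε
  refine ⟨hε'.trans_le (le_iInf₂ fun σ hσ => ?_), hε'.trans_le ?_⟩
  · obtain ⟨π, h1, h2⟩ := G.exists_mem_consistent hσ hτ (h.subset hv)
    exact (hMP' π h2).trans (le_iSup₂ (f := fun π _ => G.MP π) π h1)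
  · exact (le_iInf₂ hMP').trans
      (le_iSup₂ (f := fun τ _ => ⨅ π ∈ G.maxConsistent τ v, G.MP π) τ hτ)

theorem neg_values_of_maxTrap_dual {G : Game V} {A : Set V} {φ : V → ℤ} (h : G.dual.MaxTrap A φ)
    (hG : G.NoZeroCycle) {v : V} (hv : v ∈ A) : G.upperValue v < 0 ∧ G.lowerValue v < 0 := by
  obtain ⟨σ, hσ, ε, hε, hMP⟩ := h.exists_eventually_le hG.dual hv
  rw [isMaxStrategy_dual] at hσ
  rw [maxConsistent_dual] at hMP
  have hMP' : ∀ π ∈ G.minConsistent σ v, G.MP π ≤ ((-ε : ℝ) : EReal) := by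
    intro π hπ
    refine Filter.limsup_le_of_le (h := (hMP π hπ).mono fun k hk => EReal.coe_le_coe_iff.2 ?_)
    simp only [dual, Int.cast_neg, Finset.sum_neg_distrib, neg_div] at hk
    linarith
  have hε' : ((-ε : ℝ) : EReal) < 0 := by exact_mod_cast neg_lt_zero.2 hε
  refine ⟨lt_of_le_of_lt ?_ hε', lt_of_le_of_lt (iSup₂_le fun τ hτ => ?_) hε'⟩
  · exact (iInf₂_le (f := fun σ _ => ⨆ π ∈ G.minConsistent σ v, G.MP π) σ hσ).trans
      (iSup₂_le hMP')
  · obtain ⟨π, h1, h2⟩ := G.exists_mem_consistent hσ hτ (h.subset hv)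
    exact (iInf₂_le (f := fun π _ => G.MP π) π h2).trans (hMP' π h1)

end Game

namespace ReduceGame

variable {V : Type*}

open Game

/-! ### Certificates -/

/-- The output `o` solves `G`: each player has a trap, with respect to the potential `o.pot`, and
the two traps partition the set of vertices. -/
structure Solves (G : Game V) (o : Output V) : Prop where
  union : o.lo ∪ o.hi = G.verts
  disjoint : Disjoint o.lo o.hi
  hi : G.MaxTrap o.hi o.pot
  lo : G.dual.MaxTrap o.lo fun v => -o.pot v

theorem Solves.dual {G : Game V} {o : Output V} (h : Solves G o) : Solves G.dual o.dual where
  union := by rw [← show o.lo ∪ o.hi = G.dual.verts from h.union]; exact Set.union_comm _ _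
  disjoint := h.disjoint.symm
  hi := h.lo
  lo := by
    rw [Game.dual_dual]
    simpa [Output.dual] using h.hi

theorem Solves.orient {G : Game V} {o : Output V} {b : Bool} (h : Solves (Game.orient b G) o) :
    Solves G (o.orient b) := by
  cases b
  · exact h
  · rw [← G.dual_dual]; exact h.dual

theorem Solves.reduce {G : Game V} {φ : V → ℤ} {o : Output V} (h : Solves (G.reduce φ) o) :
    Solves G ⟨o.lo, o.hi, fun v => o.pot v + φ v⟩ where
  union := h.union
  disjoint := h.disjoint
  hi :=
    { subset := h.hi.subset
      max := fun v hv hm => by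
        obtain ⟨v', hv', e, hle⟩ := h.hi.max v hv hm
        refine ⟨v', hv', e, ?_⟩
        simp only [Game.reduce] at hle ⊢; omega
      min := fun v hv hm v' e => by
        obtain ⟨hv', hle⟩ := h.hi.min v hv hm v' e
        refine ⟨hv', ?_⟩
        simp only [Game.reduce] at hle ⊢; omega }
  lo :=
    { subset := h.lo.subset
      max := fun v hv hm => by
        obtain ⟨v', hv', e, hle⟩ := h.lo.max v hv hm
        refine ⟨v', hv', e, ?_⟩
        simp only [Game.reduce, Game.dual] at hle ⊢; omega
      min := fun v hv hm v' e => by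
        obtain ⟨hv', hle⟩ := h.lo.min v hv hm v' e
        refine ⟨hv', ?_⟩
        simp only [Game.reduce, Game.dual] at hle ⊢; omega }

theorem Solves.zones {G : Game V} {o : Output V} (h : Solves G o) (hG : G.NoZeroCycle) :
    o.lo = (G.reduce o.pot).ZN ∧ o.hi = (G.reduce o.pot).ZP := by
  have hP := h.hi.subset_ZP hG
  have hN : o.lo ⊆ (G.reduce o.pot).ZN := by
    have h1 := h.lo.subset_ZP hG.dual
    have h2 : G.dual.reduce (fun v => -o.pot v) = (G.reduce o.pot).dual := by
      simp only [Game.reduce, Game.dual, Game.mk.injEq, true_and]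
      funext v v'; ring
    rwa [h2, ZP_dual] at h1
  have hd := Set.disjoint_left.1 (G.reduce o.pot).disjoint_ZN_ZP
  have hu : ∀ v ∈ G.verts, v ∈ o.lo ∨ v ∈ o.hi := fun v hv => by
    rw [← h.union] at hv; exact hv
  constructor
  · refine hN.antisymm fun v hv => (hu v hv.1).resolve_right fun h' => hd hv (hP h')
  · refine hP.antisymm fun v hv => (hu v hv.1).resolve_left fun h' => hd (hN h') hv

theorem Solves.isReducingPotential {G : Game V} {o : Output V} (h : Solves G o)
    (hG : G.NoZeroCycle) : G.IsReducingPotential o.pot := by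
  obtain ⟨hN, hP⟩ := h.zones hG
  unfold IsReducingPotential Game.IsReduced NegReducedAt PosReducedAt
  rw [← hN, ← hP]
  refine ⟨fun v hv => ⟨fun hm => ?_, fun hm v' e => ?_⟩,
    fun v hv => ⟨fun hm => ?_, fun hm v' e => ?_⟩⟩
  · obtain ⟨v', hv', e, hle⟩ := h.lo.max v hv (by rw [maxVerts_dual]; exact hm)
    refine ⟨v', e, ?_, hv'⟩
    simp only [Game.reduce, Game.dual] at hle ⊢; omega
  · obtain ⟨hv', hle⟩ := h.lo.min v hv hm v' e
    refine ⟨?_, hv'⟩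
    simp only [Game.reduce, Game.dual] at hle ⊢; omega
  · obtain ⟨v', hv', e, hle⟩ := h.hi.max v hv hm
    refine ⟨v', e, ?_, hv'⟩
    simp only [Game.reduce] at hle ⊢; omega
  · obtain ⟨hv', hle⟩ := h.hi.min v hv hm v' e
    refine ⟨?_, hv'⟩
    simp only [Game.reduce] at hle ⊢; omega

theorem Solves.isWinningRegions {G : Game V} {o : Output V} (h : Solves G o)
    (hG : G.NoZeroCycle) : G.IsWinningRegions o.lo o.hi := by
  have hu : ∀ v ∈ G.verts, v ∈ o.lo ∨ v ∈ o.hi := fun v hv => by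
    rw [← h.union] at hv; exact hv
  intro val hval
  have hpos : ∀ v ∈ o.hi, 0 < val v := fun v hv => by
    rcases hval with rfl | rfl
    · exact (pos_values_of_maxTrap h.hi hG hv).1
    · exact (pos_values_of_maxTrap h.hi hG hv).2
  have hneg : ∀ v ∈ o.lo, val v < 0 := fun v hv => by
    rcases hval with rfl | rfl
    · exact (neg_values_of_maxTrap_dual h.lo hG hv).1
    · exact (neg_values_of_maxTrap_dual h.lo hG hv).2
  refine ⟨?_, ?_, fun v hv => ?_⟩
  · ext v
    exact ⟨fun hv => ⟨h.lo.subset hv, (hneg v hv).le⟩,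
      fun hv => (hu v hv.1).resolve_right fun h' => (hpos v h').not_ge hv.2⟩
  · ext v
    exact ⟨fun hv => ⟨h.hi.subset hv, hpos v hv⟩,
      fun hv => (hu v hv.1).resolve_left fun h' => (hneg v h').not_gt hv.2⟩
  · rcases hu v hv with h' | h'
    · exact (hneg v h').ne
    · exact (hpos v h').ne'

/-! ### Executions that cannot go wrong -/

/-- However the free choices are made, the machine halts when it is started in the given state, it
does not get stuck, and it returns an output that satisfies `post`. -/
inductive Succeeds (post : Output V → Prop) : State V → Prop
  | done (o : Output V) (h : post o) : Succeeds post (.ret o [])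
  | step (s : State V) (hex : ∃ t, Step s t) (h : ∀ t, Step s t → Succeeds post t) :
      Succeeds post s

theorem not_step_ret_nil {o : Output V} {t : State V} : ¬ Step (.ret o []) t := by
  intro h; cases h

theorem Succeeds.of_step {post : Output V → Prop} {s t : State V} (h : Succeeds post s)
    (hst : Step s t) : Succeeds post t := by
  cases h with
  | done o h => exact absurd hst not_step_ret_nil
  | step _ _ h => exact h t hst

theorem Succeeds.of_reachable {post : Output V → Prop} {s t : State V} (h : Succeeds post s)
    (hst : Relation.ReflTransGen Step s t) : Succeeds post t := by
  induction hst with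
  | refl => exact h
  | tail _ hst ih => exact ih.of_step hst

theorem Succeeds.not_infinite {post : Output V → Prop} {s : State V} (h : Succeeds post s) :
    ¬ ∃ f : ℕ → State V, f 0 = s ∧ ∀ i, Step (f i) (f (i + 1)) := by
  induction h with
  | done o h =>
    rintro ⟨f, h0, hf⟩
    exact not_step_ret_nil (h0 ▸ hf 0)
  | step s _ _ ih =>
    rintro ⟨f, h0, hf⟩
    exact ih (f 1) (h0 ▸ hf 0) ⟨fun i => f (i + 1), rfl, fun i => hf (i + 1)⟩

theorem Succeeds.progress {post : Output V → Prop} {s : State V} (h : Succeeds post s) :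
    (∃ t, Step s t) ∨ ∃ o, s = .ret o [] := by
  cases h with
  | done o h => exact Or.inr ⟨o, rfl⟩
  | step _ hex h => exact Or.inl hex

theorem Succeeds.post_of_ret {post : Output V → Prop} {o : Output V}
    (h : Succeeds post (.ret o [])) : post o := by
  cases h with
  | done o h => exact h
  | step _ hex h => exact absurd hex.choose_spec not_step_ret_nil

theorem ncard_sdiff_insert_lt {X F : Set V} (hX : X.Finite) {v : V} (hv : v ∈ X \ F) :
    (X \ insert v F).ncard < (X \ F).ncard := by
  refine Set.ncard_lt_ncard ⟨fun u hu => ⟨hu.1, fun h => hu.2 (Or.inr h)⟩, fun h => ?_⟩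
    (hX.subset Set.sdiff_subset)
  exact (h hv).2 (Or.inl rfl)

theorem assign_same (φ : V → ℤ) (v : V) (x : ℤ) : assign φ v x v = x := if_pos rfl

theorem assign_of_ne (φ : V → ℤ) {v u : V} (x : ℤ) (h : u ≠ v) : assign φ v x u = φ u := if_neg h

/-! ### Existence of optimal choices -/

theorem finite_outSums (D : Game V) (φ : V → ℤ) (v : V) : (outSums D φ v).Finite := by
  refine (D.finite.image fun v' => D.w v v' + φ v').subset ?_
  rintro x ⟨v', e, rfl⟩
  exact ⟨v', (D.edge_mem _ _ e).2, rfl⟩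

theorem exists_isLeast_outSums {D : Game V} (φ : V → ℤ) {v : V} (hv : v ∈ D.verts) :
    ∃ x, IsLeast (outSums D φ v) x := by
  obtain ⟨v', e⟩ := D.sinkless v hv
  obtain ⟨x, hx, hle⟩ :=
    Set.exists_min_image (outSums D φ v) id (finite_outSums D φ v) ⟨_, v', e, rfl⟩
  exact ⟨x, hx, hle⟩

theorem exists_isGreatest_outSums {D : Game V} (φ : V → ℤ) {v : V} (hv : v ∈ D.verts) :
    ∃ x, IsGreatest (outSums D φ v) x := by
  obtain ⟨v', e⟩ := D.sinkless v hv
  obtain ⟨x, hx, hle⟩ :=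
    Set.exists_max_image (outSums D φ v) id (finite_outSums D φ v) ⟨_, v', e, rfl⟩
  exact ⟨x, hx, hle⟩

theorem exists_edge_min {D : Game V} {X F : Set V} (f : V → V → ℤ)
    (h : ∃ v v', EdgeFromTo D X F v v') :
    ∃ v v', EdgeFromTo D X F v v' ∧ ∀ u u', EdgeFromTo D X F u u' → f v v' ≤ f u u' := by
  obtain ⟨v, v', e⟩ := h
  have hfin : {p : V × V | EdgeFromTo D X F p.1 p.2}.Finite :=
    (D.finite.prod D.finite).subset fun p hp => D.edge_mem _ _ hp.1
  obtain ⟨p, hp, hle⟩ := Set.exists_min_image _ (fun p : V × V => f p.1 p.2) hfin ⟨(v, v'), e⟩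
  exact ⟨p.1, p.2, hp, fun u u' e' => hle (u, u') e'⟩

/-! ### Subsolutions and the while loop -/

/-- A subsolution of the game in which a play is stopped, with payoff zero, when it reaches `N`,
and in which Max otherwise collects the weights. -/
structure IsSubsolution (D : Game V) (t : V → ℤ) : Prop where
  zero : ∀ v ∈ D.N, t v = 0
  max : ∀ v ∈ D.maxVerts, v ∉ D.N → ∃ v', D.E v v' ∧ t v ≤ D.w v v' + t v'
  min : ∀ v ∈ D.minVerts, v ∉ D.N → ∀ v', D.E v v' → t v ≤ D.w v v' + t v'

/-- Outside `N`, Max can force nonnegative weights. -/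
theorem isSubsolution_zero (D : Game V) : IsSubsolution D fun _ => 0 where
  zero _ _ := rfl
  max v hv hN := by
    by_contra! h
    exact hN (Or.inr ⟨hv, fun v' e => by have := h v' e; omega⟩)
  min v hv hN v' e := by
    by_contra! h
    exact hN (Or.inl ⟨hv, v', e, by omega⟩)

/-- A subsolution can be increased at vertices where the inequalities hold for the new values. -/
theorem IsSubsolution.of_le {D : Game V} {t t' : V → ℤ} (h : IsSubsolution D t)
    (hle : ∀ v, t v ≤ t' v)
    (hnew : ∀ v, t' v = t v ∨ v ∉ D.N ∧
      (v ∈ D.maxVerts → ∃ v', D.E v v' ∧ t' v ≤ D.w v v' + t' v') ∧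
      (v ∈ D.minVerts → ∀ v', D.E v v' → t' v ≤ D.w v v' + t' v')) : IsSubsolution D t' where
  zero v hv := by
    rcases hnew v with h' | h'
    · rw [h', h.zero v hv]
    · exact absurd hv h'.1
  max v hv hN := by
    rcases hnew v with h' | h'
    · obtain ⟨v', e, h1⟩ := h.max v hv hN
      exact ⟨v', e, by have := hle v'; omega⟩
    · exact h'.2.1 hv
  min v hv hN v' e := by
    rcases hnew v with h' | h'
    · have h1 := h.min v hv hN v' e
      have := hle v'; omega
    · exact h'.2.2 hv v' e

theorem IsSubsolution.assign {D : Game V} {t : V → ℤ} (h : IsSubsolution D t) {v : V} {x : ℤ}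
    (hx : t v ≤ x) (hN : v ∉ D.N)
    (hmax : v ∈ D.maxVerts → ∃ v', D.E v v' ∧ x ≤ D.w v v' + t v')
    (hmin : v ∈ D.minVerts → ∀ v', D.E v v' → x ≤ D.w v v' + t v') :
    IsSubsolution D (assign t v x) := by
  have hle : ∀ u, t u ≤ ReduceGame.assign t v x u := fun u => by
    by_cases hu : u = v
    · rw [hu, assign_same]; exact hx
    · rw [assign_of_ne _ _ hu]
  refine h.of_le hle fun u => ?_
  by_cases hu : u = v
  · subst hu
    refine Or.inr ⟨hN, fun hm => ?_, fun hm v' e => ?_⟩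
    · obtain ⟨v', e, h1⟩ := hmax hm
      refine ⟨v', e, ?_⟩
      rw [assign_same]
      have := hle v'; omega
    · have h1 := hmin hm v' e
      rw [assign_same]
      have := hle v'; omega
  · exact Or.inl (assign_of_ne _ _ hu)

/-- The invariant of the while loop: on `F`, the values found so far are those of the greatest
subsolution. -/
structure LoopInv (D : Game V) (F : Set V) (φ : V → ℤ) : Prop where
  N_subset : D.N ⊆ F
  subset : F ⊆ D.verts
  attained : ∃ t, IsSubsolution D t ∧ ∀ v ∈ F, t v = φ v
  le : ∀ t, IsSubsolution D t → ∀ v ∈ F, t v ≤ φ v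

theorem loopInv_N (D : Game V) : LoopInv D D.N fun _ => 0 where
  N_subset := subset_rfl
  subset := D.N_subset
  attained := ⟨_, isSubsolution_zero D, fun _ _ => rfl⟩
  le _ ht v hv := (ht.zero v hv).le

theorem LoopInv.insert {D : Game V} {F : Set V} {φ : V → ℤ} (h : LoopInv D F φ) {v : V} {x : ℤ}
    (hv : v ∈ D.verts \ F) (hatt : ∃ t, IsSubsolution D t ∧ (∀ u ∈ F, t u = φ u) ∧ t v = x)
    (hle : ∀ t, IsSubsolution D t → t v ≤ x) : LoopInv D (insert v F) (assign φ v x) := by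
  have hne : ∀ u ∈ F, u ≠ v := fun u hu huv => hv.2 (huv ▸ hu)
  refine ⟨h.N_subset.trans (Set.subset_insert _ _), Set.insert_subset hv.1 h.subset, ?_, ?_⟩
  · obtain ⟨t, ht, htF, htv⟩ := hatt
    refine ⟨t, ht, ?_⟩
    rintro u (rfl | hu)
    · rw [assign_same, htv]
    · rw [assign_of_ne _ _ (hne u hu), htF u hu]
  · rintro t ht u (rfl | hu)
    · rw [assign_same]; exact hle t ht
    · rw [assign_of_ne _ _ (hne u hu)]; exact h.le t ht u hu

/-- If an upper bound for the value at `v` satisfies the inequalities of a subsolution, then it is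
the value of the greatest subsolution. -/
theorem LoopInv.insert_of_le {D : Game V} {F : Set V} {φ : V → ℤ} (h : LoopInv D F φ) {v : V}
    {x : ℤ} (hv : v ∈ D.verts \ F) (hle : ∀ t, IsSubsolution D t → t v ≤ x)
    (hmax : v ∈ D.maxVerts → ∃ v' ∈ F, D.E v v' ∧ x ≤ D.w v v' + φ v')
    (hmin : v ∈ D.minVerts → ∀ v', D.E v v' → v' ∈ F ∧ x ≤ D.w v v' + φ v') :
    LoopInv D (Insert.insert v F) (assign φ v x) := by
  obtain ⟨t, ht, htF⟩ := h.attained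
  refine h.insert hv ⟨assign t v x, ht.assign (hle t ht) (fun hN => hv.2 (h.N_subset hN)) ?_ ?_,
    fun u hu => ?_, assign_same _ _ _⟩ hle
  · intro hm
    obtain ⟨v', hv', e, h1⟩ := hmax hm
    exact ⟨v', e, by rw [htF v' hv']; exact h1⟩
  · intro hm v' e
    obtain ⟨hv', h1⟩ := hmin hm v' e
    rw [htF v' hv']; exact h1
  · rw [assign_of_ne _ _ (fun huv => hv.2 (by rwa [← huv])), htF u hu]

theorem LoopInv.backtrack_min {D : Game V} {F : Set V} {φ : V → ℤ} (h : LoopInv D F φ) {v : V}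
    {x : ℤ} (hv : AllEdgesTo D F v) (hm : v ∈ D.minVerts) (hx : IsLeast (outSums D φ v) x) :
    LoopInv D (Insert.insert v F) (assign φ v x) := by
  have hN : v ∉ D.N := fun hN => hv.1.2 (h.N_subset hN)
  refine h.insert_of_le hv.1 (fun t ht => ?_)
    (fun hm' => absurd hm' (Set.disjoint_left.1 D.disjoint_minVerts_maxVerts hm))
    fun _ v' e => ⟨hv.2 v' e, hx.2 ⟨v', e, rfl⟩⟩
  obtain ⟨v', e, rfl⟩ := hx.1
  have h1 := ht.min v hm hN v' e
  have h2 := h.le t ht v' (hv.2 v' e)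
  omega

theorem LoopInv.backtrack_max {D : Game V} {F : Set V} {φ : V → ℤ} (h : LoopInv D F φ) {v : V}
    {x : ℤ} (hv : AllEdgesTo D F v) (hm : v ∈ D.maxVerts) (hx : IsGreatest (outSums D φ v) x) :
    LoopInv D (Insert.insert v F) (assign φ v x) := by
  have hN : v ∉ D.N := fun hN => hv.1.2 (h.N_subset hN)
  refine h.insert_of_le hv.1 (fun t ht => ?_) (fun _ => ?_)
    (fun hm' => absurd hm (Set.disjoint_left.1 D.disjoint_minVerts_maxVerts hm'))
  · obtain ⟨v', e, h1⟩ := ht.max v hm hN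
    have h2 := h.le t ht v' (hv.2 v' e)
    have h3 : D.w v v' + φ v' ≤ x := hx.2 ⟨v', e, rfl⟩
    omega
  · obtain ⟨v', e, rfl⟩ := hx.1
    exact ⟨v', hv.2 v' e, e, le_rfl⟩

section Escape

variable {D : Game V} {F : Set V} {φ : V → ℤ} {o : Output V} {v v' : V}
  {hH : ∀ v ∈ D.verts \ F, ∃ v' ∈ D.verts \ F, D.E v v'}

/-- Max can stay in `H⁺` at no loss until Min escapes, and the best escape for Min is `vv'`. Hence
the potential of the subgame, shifted by a constant, is a subsolution on `H⁺`. -/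
theorem LoopInv.escape_min (h : LoopInv D F φ)
    (ho : Solves (D.restrict (D.verts \ F) Set.sdiff_subset hH) o)
    (he : EdgeFromTo D (o.hi ∩ D.minVerts) F v v')
    (hopt : ∀ u u', EdgeFromTo D (o.hi ∩ D.minVerts) F u u' →
      D.w v v' + φ v' - o.pot v ≤ D.w u u' + φ u' - o.pot u) :
    LoopInv D (Insert.insert v F) (assign φ v (D.w v v' + φ v')) := by
  classical
  obtain ⟨e, ⟨hv, hm⟩, hv'⟩ := he
  have hsub : o.hi ⊆ D.verts \ F := ho.hi.subset
  have hN : ∀ u ∈ o.hi, u ∉ D.N := fun u hu huN => (hsub hu).2 (h.N_subset huN)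
  have hle : ∀ t, IsSubsolution D t → t v ≤ D.w v v' + φ v' := fun t ht => by
    have h1 := ht.min v hm (hN v hv) v' e
    have h2 := h.le t ht v' hv'
    omega
  refine h.insert (hsub hv) ?_ hle
  obtain ⟨t, ht, htF⟩ := h.attained
  set m := D.w v v' + φ v' - o.pot v with hmdef
  let t' : V → ℤ := fun u => if u ∈ o.hi then max (t u) (m + o.pot u) else t u
  have ht'hi : ∀ u ∈ o.hi, t' u = max (t u) (m + o.pot u) := fun u hu => if_pos hu
  have ht'F : ∀ u, u ∉ o.hi → t' u = t u := fun u hu => if_neg hu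
  have hlet : ∀ u, t u ≤ t' u := fun u => by
    by_cases hu : u ∈ o.hi
    · rw [ht'hi u hu]; exact le_max_left _ _
    · rw [ht'F u hu]
  have hgeP : ∀ u ∈ o.hi, m + o.pot u ≤ t' u := fun u hu => by
    rw [ht'hi u hu]; exact le_max_right _ _
  refine ⟨t', ht.of_le hlet fun u => ?_, fun u hu => ?_, ?_⟩
  · by_cases hu : u ∈ o.hi
    swap
    · exact Or.inl (ht'F u hu)
    rcases le_total (m + o.pot u) (t u) with hcmp | hcmp
    · exact Or.inl (by rw [ht'hi u hu, max_eq_left hcmp])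
    have ht'u : t' u = m + o.pot u := by rw [ht'hi u hu, max_eq_right hcmp]
    refine Or.inr ⟨hN u hu, fun hum => ?_, fun hum u' e' => ?_⟩
    · obtain ⟨u', hu', e', h1⟩ := ho.hi.max u hu ⟨hsub hu, hum.2⟩
      refine ⟨u', e'.1, ?_⟩
      have h1 : o.pot u ≤ D.w u u' + o.pot u' := h1
      have h2 := hgeP u' hu'
      omega
    · by_cases hu' : u' ∈ F
      · have h1 := hopt u u' ⟨e', ⟨hu, hum⟩, hu'⟩
        have h2 := hlet u'
        rw [htF u' hu'] at h2
        omega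
      · obtain ⟨h1, h2⟩ := ho.hi.min u hu ⟨hsub hu, hum.2⟩ u'
          ⟨e', hsub hu, (D.edge_mem _ _ e').2, hu'⟩
        have h2 : o.pot u ≤ D.w u u' + o.pot u' := h2
        have h3 := hgeP u' h1
        omega
  · rw [ht'F u fun hu' => (hsub hu').2 hu, htF u hu]
  · have h1 := hle t ht
    rw [ht'hi v hv]
    omega

/-- If `H⁺` is empty, then Min can stay in `H` at no loss until Max escapes, and the best escape for
Max is `vv'`. Hence no subsolution exceeds a shift of the potential of the subgame: at vertices
where the excess is maximal, zero edges could be followed forever. -/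
theorem LoopInv.escape_max (h : LoopInv D F φ) (hD : D.NoZeroCycle)
    (ho : Solves (D.restrict (D.verts \ F) Set.sdiff_subset hH) o) (hempty : o.hi = ∅)
    (he : EdgeFromTo D ((D.verts \ F) ∩ D.maxVerts) F v v')
    (hopt : ∀ u u', EdgeFromTo D ((D.verts \ F) ∩ D.maxVerts) F u u' →
      D.w u u' + φ u' - o.pot u ≤ D.w v v' + φ v' - o.pot v) :
    LoopInv D (Insert.insert v F) (assign φ v (D.w v v' + φ v')) := by
  obtain ⟨e, ⟨hv, hm⟩, hv'⟩ := he
  have hlo : o.lo = D.verts \ F := by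
    have := ho.union
    rw [hempty, Set.union_empty] at this; exact this
  refine h.insert_of_le hv (fun t ht => ?_) (fun _ => ⟨v', hv', e, le_rfl⟩)
    (fun hm' => absurd hm (Set.disjoint_left.1 D.disjoint_minVerts_maxVerts hm'))
  by_contra! hlt
  obtain ⟨z, hz, hzmax⟩ := Set.exists_max_image (D.verts \ F) (fun u => t u - o.pot u)
    (D.finite.subset Set.sdiff_subset) ⟨v, hv⟩
  have hzv := hzmax v hv
  have key : {u ∈ D.verts \ F | t u - o.pot u = t z - o.pot z} = ∅ := by
    refine (hD.reduce o.pot).eq_empty_of_forall_exists_zero ?_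
    rintro u ⟨hu, huz⟩
    have huN : u ∉ D.N := fun hN => hu.2 (h.N_subset hN)
    -- it suffices to find an edge inside `H` that is good for Min and respects the subsolution
    suffices hs : ∃ u' ∈ D.verts \ F, D.E u u' ∧ D.w u u' + o.pot u' ≤ o.pot u ∧
        t u ≤ D.w u u' + t u' by
      obtain ⟨u', hu', e', h1, h2⟩ := hs
      have h3 := hzmax u' hu'
      refine ⟨u', ⟨hu', by omega⟩, e', ?_⟩
      simp only [Game.reduce]; omega
    rcases D.mem_minVerts_or_mem_maxVerts hu.1 with hum | hum
    · obtain ⟨u', hu', e', h1⟩ := ho.lo.max u (hlo ▸ hu)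
        (by rw [maxVerts_dual]; exact ⟨hu, hum.2⟩)
      have h1 : - o.pot u ≤ - D.w u u' + - o.pot u' := h1
      have e' : D.E u u' := e'.1
      exact ⟨u', hlo ▸ hu', e', by omega, ht.min u hum huN u' e'⟩
    · obtain ⟨u', e', h1⟩ := ht.max u hum huN
      have hu' : u' ∉ F := fun hu' => by
        have h2 := hopt u u' ⟨e', ⟨hu, hum⟩, hu'⟩
        have h3 := h.le t ht u' hu'
        omega
      have hu'' : u' ∈ D.verts \ F := ⟨(D.edge_mem _ _ e').2, hu'⟩
      obtain ⟨-, h2⟩ := ho.lo.min u (hlo ▸ hu) ⟨hu, hum.2⟩ u' ⟨e', hu, hu''⟩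
      have h2 : - o.pot u ≤ - D.w u u' + - o.pot u' := h2
      exact ⟨u', hu'', e', by omega, h1⟩
  have hz' : z ∈ {u ∈ D.verts \ F | t u - o.pot u = t z - o.pot z} := ⟨hz, rfl⟩
  rw [key] at hz'
  exact hz'

/-- Otherwise Max could stay in `H` with edges of weight `≥ 0`, as no vertex of `H` is in `N`. -/
theorem LoopInv.exists_escape_max (h : LoopInv D F φ) (hD : D.NoZeroCycle)
    (ho : Solves (D.restrict (D.verts \ F) Set.sdiff_subset hH) o) (hempty : o.hi = ∅)
    (hne : o.lo.Nonempty) : ∃ v v', EdgeFromTo D ((D.verts \ F) ∩ D.maxVerts) F v v' := by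
  by_contra! hno
  have hlo : o.lo = D.verts \ F := by
    have := ho.union
    rw [hempty, Set.union_empty] at this; exact this
  have htrap : (D.restrict (D.verts \ F) Set.sdiff_subset hH).MaxTrap (D.verts \ F)
      fun _ => 0 := by
    refine ⟨subset_rfl, fun u hu hum => ?_, fun u hu hum u' e => ⟨e.2.2, ?_⟩⟩
    · obtain ⟨u', e, h1⟩ := (isSubsolution_zero D).max u ⟨hu.1, hum.2⟩
        fun hN => hu.2 (h.N_subset hN)
      have hu' : u' ∈ D.verts \ F := ⟨(D.edge_mem _ _ e).2, fun hF =>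
        hno u u' ⟨e, ⟨hu, hu.1, hum.2⟩, hF⟩⟩
      exact ⟨u', hu', ⟨e, hu, hu'⟩, h1⟩
    · exact (isSubsolution_zero D).min u ⟨hu.1, hum.2⟩ (fun hN => hu.2 (h.N_subset hN)) u' e.1
  obtain ⟨u, hu⟩ := hne
  have hDH := hD.restrict Set.sdiff_subset hH
  exact (pos_values_of_maxTrap htrap hDH (hlo ▸ hu)).1.not_gt
    (neg_values_of_maxTrap_dual ho.lo hDH hu).1

/-- If Min cannot escape from `H⁺` to `F`, then `H⁺` is a trap in the whole game. -/
theorem maxTrap_of_no_escape (ho : Solves (D.restrict (D.verts \ F) Set.sdiff_subset hH) o)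
    (hno : ¬ ∃ v v', EdgeFromTo D (o.hi ∩ D.minVerts) F v v') : D.MaxTrap o.hi o.pot := by
  have hsub : o.hi ⊆ D.verts \ F := ho.hi.subset
  refine ⟨fun u hu => (hsub hu).1, fun u hu hum => ?_, fun u hu hum u' e => ?_⟩
  · obtain ⟨u', hu', e, h1⟩ := ho.hi.max u hu ⟨hsub hu, hum.2⟩
    exact ⟨u', hu', e.1, h1⟩
  · have hu' : u' ∉ F := fun hu' => hno ⟨u, u', e, ⟨hu, hum⟩, hu'⟩
    exact ho.hi.min u hu ⟨hsub hu, hum.2⟩ u' ⟨e, hsub hu, (D.edge_mem _ _ e).2, hu'⟩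

end Escape

/-- When all vertices have been processed, the vertices outside `N` have optimal edges of weight
zero in the game reduced by the values that were found. -/
theorem LoopInv.N_P_subset {D : Game V} {F : Set V} {φ : V → ℤ} (h : LoopInv D F φ)
    (hF : D.verts ⊆ F) : (D.reduce φ).N ⊆ D.N ∧ (D.reduce φ).P ⊆ D.N := by
  obtain ⟨t, ht, htF⟩ := h.attained
  have htE : ∀ {v v'}, D.E v v' → t v = φ v ∧ t v' = φ v' := fun e =>
    ⟨htF _ (hF (D.edge_mem _ _ e).1), htF _ (hF (D.edge_mem _ _ e).2)⟩
  refine ⟨fun v hv => ?_, fun v hv => ?_⟩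
  · by_contra hN
    rcases hv with ⟨hm, v', e, hlt⟩ | ⟨hm, hlt⟩
    · have h1 := ht.min v hm hN v' e
      have h2 := htE e
      simp only [Game.reduce] at hlt; omega
    · obtain ⟨v', e, h1⟩ := ht.max v hm hN
      have h2 := htE e
      have hlt := hlt v' e
      simp only [Game.reduce] at hlt; omega
  · -- at a vertex of `P` outside `N`, the greatest subsolution could be increased
    by_contra hN
    have hvv : v ∈ D.verts := (D.reduce φ).P_subset hv
    have hnew : IsSubsolution D (assign t v (t v + 1)) := by
      refine ht.assign (by omega) hN (fun hm => ?_) (fun hm v' e => ?_)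
      · rcases hv with ⟨hm', _⟩ | ⟨_, v', e, hlt⟩
        · exact absurd hm (Set.disjoint_left.1 D.disjoint_minVerts_maxVerts hm')
        · refine ⟨v', e, ?_⟩
          have h2 := htE e
          simp only [Game.reduce] at hlt; omega
      · rcases hv with ⟨_, hlt⟩ | ⟨hm', _⟩
        · have h2 := htE e
          have hlt := hlt v' e
          simp only [Game.reduce] at hlt; omega
        · exact absurd hm' (Set.disjoint_left.1 D.disjoint_minVerts_maxVerts hm)
    have h1 := h.le _ hnew v (hF hvv)
    rw [assign_same, ← htF v (hF hvv)] at h1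
    omega

/-! ### Backtracking and gluing -/

theorem maxTrap_insert {D : Game V} {A : Set V} {φ : V → ℤ} (h : D.MaxTrap A φ) {v : V} {x : ℤ}
    (hv : v ∈ D.verts \ A) (hmax : v ∈ D.maxVerts → ∃ v' ∈ A, D.E v v' ∧ x ≤ D.w v v' + φ v')
    (hmin : v ∈ D.minVerts → ∀ v', D.E v v' → v' ∈ A ∧ x ≤ D.w v v' + φ v') :
    D.MaxTrap (Insert.insert v A) (assign φ v x) := by
  have hA : ∀ u ∈ A, assign φ v x u = φ u := fun u hu =>
    assign_of_ne _ _ fun huv => hv.2 (by rwa [← huv])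
  refine ⟨Set.insert_subset hv.1 h.subset, ?_, ?_⟩
  · rintro u (rfl | hu) hm
    · obtain ⟨v', hv', e, h1⟩ := hmax hm
      exact ⟨v', Or.inr hv', e, by rw [assign_same, hA v' hv']; exact h1⟩
    · obtain ⟨v', hv', e, h1⟩ := h.max u hu hm
      exact ⟨v', Or.inr hv', e, by rw [hA u hu, hA v' hv']; exact h1⟩
  · rintro u (rfl | hu) hm v' e
    · obtain ⟨hv', h1⟩ := hmin hm v' e
      exact ⟨Or.inr hv', by rw [assign_same, hA v' hv']; exact h1⟩
    · obtain ⟨hv', h1⟩ := h.min u hu hm v' e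
      exact ⟨Or.inr hv', by rw [hA u hu, hA v' hv']; exact h1⟩

theorem maxTrap_attract_min {D : Game V} {A : Set V} {φ : V → ℤ} (h : D.MaxTrap A φ) {v : V}
    {x : ℤ} (hv : MaxAttracted D A v) (hm : v ∈ D.minVerts) (hx : IsLeast (outSums D φ v) x) :
    D.MaxTrap (Insert.insert v A) (assign φ v x) := by
  have hm' : v ∉ D.maxVerts := Set.disjoint_left.1 D.disjoint_minVerts_maxVerts hm
  refine maxTrap_insert h hv.1 (fun h' => absurd h' hm') fun _ v' e => ⟨?_, hx.2 ⟨v', e, rfl⟩⟩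
  rcases hv.2 with h' | h'
  · exact h'.2 v' e
  · exact absurd h'.1 hm'

theorem maxTrap_attract_max {D : Game V} {A : Set V} {φ : V → ℤ} (h : D.MaxTrap A φ) {v v' : V}
    (hv : MaxAttracted D A v) (hm : v ∈ D.maxVerts) (e : D.E v v') (hv' : v' ∈ A) :
    D.MaxTrap (Insert.insert v A) (assign φ v (D.w v v' + φ v')) :=
  maxTrap_insert h hv.1 (fun _ => ⟨v', hv', e, le_rfl⟩)
    fun hm' => absurd hm (Set.disjoint_left.1 D.disjoint_minVerts_maxVerts hm')

theorem exists_gluingConstant {D : Game V} {A : Set V} (φA φ' : V → ℤ) (hA : A ⊆ D.verts) :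
    ∃ δ, GluingConstant D A φA φ' δ := by
  by_cases h : ∃ v v', EdgeFromTo D (D.verts \ A) A v v'
  · obtain ⟨u, u', he, hmin⟩ := exists_edge_min D.w h
    obtain ⟨x, hx, hxmin⟩ := Set.exists_min_image A φA (D.finite.subset hA) ⟨u', he.2.2⟩
    obtain ⟨y, hy, hymax⟩ := Set.exists_max_image (D.verts \ A) φ'
      (D.finite.subset Set.sdiff_subset) ⟨u, he.2.1⟩
    refine ⟨_, fun _ => ⟨D.w u u', φA x, φ' y, ⟨⟨u, u', he, rfl⟩, ?_⟩, ⟨⟨x, hx, rfl⟩, ?_⟩,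
      ⟨⟨y, hy, rfl⟩, ?_⟩, rfl⟩⟩
    · rintro _ ⟨v, v', he', rfl⟩; exact hmin v v' he'
    · rintro _ ⟨v, hv, rfl⟩; exact hxmin v hv
    · rintro _ ⟨v, hv, rfl⟩; exact hymax v hv
  · exact ⟨0, fun h' => absurd h' h⟩

/-- The gluing constant makes all edges towards `A` nonnegative; only Min has such edges. -/
theorem Solves.glue {D : Game V} {A : Set V} {φA : V → ℤ} {o : Output V} {δ : ℤ}
    {h : ∀ v ∈ D.verts \ A, ∃ v' ∈ D.verts \ A, D.E v v'}
    (ho : Solves (D.restrict (D.verts \ A) Set.sdiff_subset h) o) (hA : D.MaxTrap A φA)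
    (hattr : ¬ ∃ v, MaxAttracted D A v) (hδ : GluingConstant D A φA o.pot δ) :
    Solves D ⟨o.lo, o.hi ∪ A, glue A φA δ o.pot⟩ := by
  have hhi : o.hi ⊆ D.verts \ A := ho.hi.subset
  have hlo : o.lo ⊆ D.verts \ A := ho.lo.subset
  have gA : ∀ u ∈ A, ReduceGame.glue A φA δ o.pot u = φA u + δ := fun u hu => if_pos hu
  have gn : ∀ u ∉ A, ReduceGame.glue A φA δ o.pot u = o.pot u := fun u hu => if_neg hu
  have hmaxE : ∀ u ∈ D.verts \ A, u ∈ D.maxVerts → ∀ u', D.E u u' → u' ∈ D.verts \ A :=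
    fun u hu hm u' e => ⟨(D.edge_mem _ _ e).2, fun hu' => hattr ⟨u, hu, Or.inr ⟨hm, u', hu', e⟩⟩⟩
  constructor
  · have h1 : o.lo ∪ o.hi = D.verts \ A := ho.union
    simp only
    rw [← Set.union_assoc, h1, Set.sdiff_union_of_subset hA.subset]
  · exact Set.disjoint_union_right.2
      ⟨ho.disjoint, Set.disjoint_left.2 fun u hu hu' => (hlo hu).2 hu'⟩
  · refine ⟨Set.union_subset (fun u hu => (hhi hu).1) hA.subset, ?_, ?_⟩
    · rintro u (hu | hu) hm
      · obtain ⟨u', hu', e, h1⟩ := ho.hi.max u hu ⟨hhi hu, hm.2⟩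
        exact ⟨u', Or.inl hu', e.1, by simp only [gn u (hhi hu).2, gn u' (hhi hu').2]; exact h1⟩
      · obtain ⟨u', hu', e, h1⟩ := hA.max u hu hm
        exact ⟨u', Or.inr hu', e, by simp only [gA u hu, gA u' hu']; omega⟩
    · rintro u (hu | hu) hm u' e
      · by_cases hu' : u' ∈ A
        · have he : EdgeFromTo D (D.verts \ A) A u u' := ⟨e, hhi hu, hu'⟩
          obtain ⟨a, b, c, ha, hb, hc, rfl⟩ := hδ ⟨u, u', he⟩
          have h1 := ha.2 ⟨u, u', he, rfl⟩
          have h2 := hb.2 ⟨u', hu', rfl⟩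
          have h3 := hc.2 ⟨u, hhi hu, rfl⟩
          exact ⟨Or.inr hu', by simp only [gn u (hhi hu).2, gA u' hu']; omega⟩
        · obtain ⟨h1, h2⟩ := ho.hi.min u hu ⟨hhi hu, hm.2⟩ u'
            ⟨e, hhi hu, (D.edge_mem _ _ e).2, hu'⟩
          exact ⟨Or.inl h1, by simp only [gn u (hhi hu).2, gn u' hu']; exact h2⟩
      · obtain ⟨hu', h1⟩ := hA.min u hu hm u' e
        exact ⟨Or.inr hu', by simp only [gA u hu, gA u' hu']; omega⟩
  · refine ⟨fun u hu => (hlo hu).1, fun u hu hm => ?_, fun u hu hm u' e => ?_⟩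
    · obtain ⟨u', hu', e, h1⟩ := ho.lo.max u hu ⟨hlo hu, hm.2⟩
      exact ⟨u', hu', e.1, by simp only [gn u (hlo hu).2, gn u' (hlo hu').2]; exact h1⟩
    · have hu' := hmaxE u (hlo hu) hm u' e
      obtain ⟨h1, h2⟩ := ho.lo.min u hu ⟨hlo hu, hm.2⟩ u' ⟨e, hlo hu, hu'⟩
      exact ⟨h1, by simp only [gn u (hlo hu).2, gn u' hu'.2]; exact h2⟩

/-! ### The zones -/

theorem solves_of_reducedTest {G : Game V} {U : Set V} (hU : U ⊆ G.verts)
    (h : ReducedTest G U) : Solves G ⟨U, G.verts \ U, fun _ => 0⟩ := by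
  obtain ⟨h1, h2, h3, h4⟩ := h
  refine ⟨Set.union_sdiff_cancel hU, Set.disjoint_sdiff_right,
    ⟨Set.sdiff_subset, fun u hu hm => ?_, fun u hu hm u' e => ?_⟩,
    ⟨hU, fun u hu hm => ?_, fun u hu hm u' e => ?_⟩⟩
  · obtain ⟨u', e, hu', hle⟩ := h3 u ⟨hm, hu.2⟩
    exact ⟨u', hu', e, by simpa using hle⟩
  · obtain ⟨hu', hle⟩ := h4 u ⟨hm, hu.2⟩ u' e
    exact ⟨hu', by simpa using hle⟩
  · rw [maxVerts_dual] at hm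
    obtain ⟨u', e, hu', hle⟩ := h1 u ⟨hm, hu⟩
    exact ⟨u', hu', e, by simpa [Game.dual] using hle⟩
  · obtain ⟨hu', hle⟩ := h2 u ⟨hm, hu⟩ u' e
    exact ⟨hu', by simpa [Game.dual] using hle⟩

/-- If `N` is empty, then so is the zone of Min, and the game is reduced. -/
theorem reducedTest_empty {G : Game V} (hN : G.N = ∅) : ReducedTest G ∅ := by
  have hN : ∀ v, v ∉ G.N := fun v hv => by rw [hN] at hv; exact hv
  refine ⟨fun v hv => hv.2.elim, fun v hv => hv.2.elim, fun v hv => ?_, fun v hv v' e => ?_⟩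
  · obtain ⟨v', e, h⟩ := (isSubsolution_zero G).max v hv.1 (hN v)
    exact ⟨v', e, ⟨(G.edge_mem _ _ e).2, id⟩, by simpa using h⟩
  · exact ⟨⟨(G.edge_mem _ _ e).2, id⟩, by
      simpa using (isSubsolution_zero G).min v hv.1 (hN v) v' e⟩

theorem ZoneAddable.mem_verts {G : Game V} {U : Set V} {v : V} (h : ZoneAddable G U v) :
    v ∈ G.verts := by
  rcases h.2 with h | h
  · exact h.1.1
  · exact h.1.1

theorem not_zoneAddable_empty {G : Game V} (hN : G.N = ∅) (v : V) : ¬ ZoneAddable G ∅ v := by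
  rintro ⟨hv, ⟨_, v', _, _, h⟩ | ⟨hm, h⟩⟩
  · exact h
  · obtain ⟨v', e, hle⟩ := (isSubsolution_zero G).max v hm (by simp [hN])
    have h1 : G.w v v' ≠ 0 := fun h0 => h v' e h0
    exact hv (Or.inl (Or.inr ⟨hm, v', e, by omega⟩))

/-- If `P` is empty, then in the complement of the computed zone, zero edges can be followed
forever; hence this complement is empty, and the game is reduced. -/
theorem reducedTest_of_P_eq_empty {G : Game V} (hG : G.NoZeroCycle) {U : Set V} (hP : G.P = ∅)
    (hN : G.N ⊆ U) (hU : ¬ ∃ v, ZoneAddable G U v) : ReducedTest G U := by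
  have hPd : G.dual.N = ∅ := by rw [N_dual, hP]
  have hnP : ∀ v, v ∉ G.dual.N := fun v hv => by rw [hPd] at hv; exact hv
  have hmin : ∀ v ∈ G.minVerts, ∃ v', G.E v v' ∧ G.w v v' ≤ 0 := fun v hv => by
    obtain ⟨v', e, h⟩ := (isSubsolution_zero G.dual).max v (by rwa [maxVerts_dual]) (hnP v)
    exact ⟨v', e, by simpa [Game.dual] using h⟩
  have hmax : ∀ v ∈ G.maxVerts, ∀ v', G.E v v' → G.w v v' ≤ 0 := fun v hv v' e => by
    simpa [Game.dual] using (isSubsolution_zero G.dual).min v hv (hnP v) v' e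
  have hempty : G.verts \ U = ∅ := by
    refine hG.eq_empty_of_forall_exists_zero fun v hv => ?_
    have hvN : v ∉ G.N := fun h => hv.2 (hN h)
    have hvPU : v ∉ G.P ∪ U := by simp [hP, hv.2]
    rcases G.mem_minVerts_or_mem_maxVerts hv.1 with hm | hm
    · obtain ⟨v', e, h⟩ := hmin v hm
      have h0 := (isSubsolution_zero G).min v hm hvN v' e
      have h0 : G.w v v' = 0 := by omega
      exact ⟨v', ⟨(G.edge_mem _ _ e).2, fun hv' =>
        hU ⟨v, hvPU, Or.inl ⟨hm, v', e, h0, hv'⟩⟩⟩, e, h0⟩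
    · have h1 : ¬ ∀ v', G.E v v' → G.w v v' = 0 → v' ∈ U := fun h =>
        hU ⟨v, hvPU, Or.inr ⟨hm, h⟩⟩
      push Not at h1
      obtain ⟨v', e, h0, hv'⟩ := h1
      exact ⟨v', ⟨(G.edge_mem _ _ e).2, hv'⟩, e, h0⟩
  have hall : ∀ v ∈ G.verts, v ∈ U := fun v hv => by
    by_contra h
    have : v ∈ G.verts \ U := ⟨hv, h⟩
    rw [hempty] at this; exact this
  refine ⟨fun v hv => ?_, fun v hv v' e => ⟨hall _ (G.edge_mem _ _ e).2, hmax v hv.1 v' e⟩,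
    fun v hv => absurd (hall v hv.1.1) hv.2, fun v hv => absurd (hall v hv.1.1) hv.2⟩
  obtain ⟨v', e, h⟩ := hmin v hv.1
  exact ⟨v', e, hall _ (G.edge_mem _ _ e).2, h⟩

/-! ### Termination and correctness -/

/-- The rank of a game, which decreases lexicographically in recursive calls: the number of
vertices, and the smaller one of the cardinalities of `N` and `P`. -/
noncomputable def rank (G : Game V) : ℕ ×ₗ ℕ :=
  toLex (G.verts.ncard, min G.N.ncard G.P.ncard)

theorem rank_dual (G : Game V) : rank G.dual = rank G := by
  simp only [rank, N_dual, P_dual, min_comm]; rfl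

theorem rank_orient (b : Bool) (G : Game V) : rank (Game.orient b G) = rank G := by
  cases b
  · rfl
  · exact rank_dual G

theorem rank_restrict_lt {D : Game V} {A : Set V} (hA : A ⊆ D.verts) (hne : A.Nonempty)
    (h : ∀ v ∈ D.verts \ A, ∃ v' ∈ D.verts \ A, D.E v v') :
    rank (D.restrict (D.verts \ A) Set.sdiff_subset h) < rank D := by
  refine Prod.Lex.toLex_lt_toLex.2 (Or.inl (Set.ncard_lt_ncard ⟨Set.sdiff_subset, fun hs => ?_⟩
    D.finite))
  obtain ⟨v, hv⟩ := hne
  exact (hs (hA hv)).2 hv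

theorem LoopInv.rank_reduce_lt {D : Game V} {F : Set V} {φ : V → ℤ} (h : LoopInv D F φ)
    (hF : D.verts ⊆ F) (hN : D.N.Nonempty) (hNP : D.N.ncard ≤ D.P.ncard) :
    rank (D.reduce φ) < rank D := by
  obtain ⟨h1, h2⟩ := h.N_P_subset hF
  have hfin := D.finite.subset D.N_subset
  have h3 : (D.reduce φ).N.ncard + (D.reduce φ).P.ncard ≤ D.N.ncard := by
    rw [← Set.ncard_union_eq (D.reduce φ).disjoint_N_P (hfin.subset h1) (hfin.subset h2)]
    exact Set.ncard_le_ncard (Set.union_subset h1 h2) hfin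
  have h4 : 0 < D.N.ncard := (Set.ncard_pos hfin).2 hN
  refine Prod.Lex.toLex_lt_toLex.2 (Or.inr ⟨rfl, ?_⟩)
  simp only
  omega

/-- Recursive calls on games of smaller rank than `D` succeed, provided that the execution succeeds
after each return of a solution. -/
def CallsSucceed (post : Output V → Prop) (D : Game V) : Prop :=
  ∀ G : Game V, G.NoZeroCycle → rank G < rank D → ∀ k,
    (∀ o, Solves G o → Succeeds post (.ret o k)) → Succeeds post (.call G k)

section Machine

variable {post : Output V → Prop} {D : Game V} {b : Bool} {k : List (Frame V)}

theorem succeeds_attract (hD : D.NoZeroCycle) (hcalls : CallsSucceed post D)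
    (hk : ∀ o, Solves D o → Succeeds post (.ret (o.orient b) k)) {A : Set V} {φA : V → ℤ}
    (hA : D.MaxTrap A φA) (hne : A.Nonempty) : Succeeds post (.attract b D A φA k) := by
  induction hn : (D.verts \ A).ncard using Nat.strong_induction_on generalizing A φA with
  | h n ih =>
    subst hn
    have hlt : ∀ {v}, MaxAttracted D A v → (D.verts \ insert v A).ncard < (D.verts \ A).ncard :=
      fun hv => ncard_sdiff_insert_lt D.finite hv.1
    refine .step _ ?_ fun t hst => ?_
    · by_cases hex : ∃ v, MaxAttracted D A v
      · obtain ⟨v, hv⟩ := hex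
        rcases D.mem_minVerts_or_mem_maxVerts hv.1.1 with hm | hm
        · obtain ⟨x, hx⟩ := exists_isLeast_outSums φA hv.1.1
          exact ⟨_, .attract_min b D A φA k v x hv hm hx⟩
        · rcases hv.2 with h | ⟨-, v', hv', e⟩
          · exact absurd hm (Set.disjoint_left.1 D.disjoint_minVerts_maxVerts h.1)
          · exact ⟨_, .attract_max b D A φA k v v' hv hm e hv'⟩
      · refine ⟨_, .recurse_rest b D A φA k hex fun v hv => ?_⟩
        rcases D.mem_minVerts_or_mem_maxVerts hv.1 with hm | hm
        · by_contra! hno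
          exact hex ⟨v, hv, Or.inl ⟨hm, fun v' e => by
            by_contra hv'
            exact hno v' ⟨(D.edge_mem _ _ e).2, hv'⟩ e⟩⟩
        · obtain ⟨v', e⟩ := D.sinkless v hv.1
          exact ⟨v', ⟨(D.edge_mem _ _ e).2, fun hv' =>
            hex ⟨v, hv, Or.inr ⟨hm, v', hv', e⟩⟩⟩, e⟩
    · cases hst with
      | attract_min _ _ _ _ _ v x hv hm hx =>
        exact ih _ (hlt hv) (maxTrap_attract_min hA hv hm hx) (Set.insert_nonempty _ _) rfl
      | attract_max _ _ _ _ _ v v' hv hm e hv' =>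
        exact ih _ (hlt hv) (maxTrap_attract_max hA hv hm e hv') (Set.insert_nonempty _ _) rfl
      | recurse_rest _ _ _ _ _ hattr hG' =>
        refine hcalls _ ((hD.restrict _ hG').orient b)
          (by rw [rank_orient]; exact rank_restrict_lt hA.subset hne hG') _ fun o ho => ?_
        refine .step _ ?_ fun t hst => ?_
        · obtain ⟨δ, hδ⟩ := exists_gluingConstant φA (o.orient b).pot hA.subset
          exact ⟨_, .return_rest b D A φA k o _ δ rfl hδ⟩
        · cases hst with
          | return_rest _ _ _ _ _ _ o' δ ho' hδ =>
            subst ho'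
            exact hk _ (ho.orient.glue hA hattr hδ)

theorem succeeds_loop (hD : D.NoZeroCycle) (hcalls : CallsSucceed post D)
    (hk : ∀ o, Solves D o → Succeeds post (.ret (o.orient b) k)) (hN : D.N.Nonempty)
    (hNP : D.N.ncard ≤ D.P.ncard) {F : Set V} {φ : V → ℤ} (h : LoopInv D F φ) :
    Succeeds post (.loop b D F φ k) := by
  induction hn : (D.verts \ F).ncard using Nat.strong_induction_on generalizing F φ with
  | h n ih =>
    subst hn
    have hlt : ∀ {v}, v ∈ D.verts \ F → (D.verts \ insert v F).ncard < (D.verts \ F).ncard :=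
      fun hv => ncard_sdiff_insert_lt D.finite hv
    refine .step _ ?_ fun t hst => ?_
    · by_cases hex : ∃ v, AllEdgesTo D F v
      · obtain ⟨v, hv⟩ := hex
        rcases D.mem_minVerts_or_mem_maxVerts hv.1.1 with hm | hm
        · obtain ⟨x, hx⟩ := exists_isLeast_outSums φ hv.1.1
          exact ⟨_, .backtrack_min b D F φ k v x hv hm hx⟩
        · obtain ⟨x, hx⟩ := exists_isGreatest_outSums φ hv.1.1
          exact ⟨_, .backtrack_max b D F φ k v x hv hm hx⟩
      · refine ⟨_, .recurse_sub b D F φ k hex fun v hv => ?_⟩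
        by_contra! hno
        exact hex ⟨v, hv, fun v' e => by
          by_contra hv'
          exact hno v' ⟨(D.edge_mem _ _ e).2, hv'⟩ e⟩
    · cases hst with
      | backtrack_min _ _ _ _ _ v x hv hm hx =>
        exact ih _ (hlt hv.1) (h.backtrack_min hv hm hx) rfl
      | backtrack_max _ _ _ _ _ v x hv hm hx =>
        exact ih _ (hlt hv.1) (h.backtrack_max hv hm hx) rfl
      | recurse_sub _ _ _ _ _ hF hH =>
        refine hcalls _ ((hD.restrict _ hH).orient b)
          (by rw [rank_orient]; exact rank_restrict_lt h.subset (hN.mono h.N_subset) hH) _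
          fun o ho => ?_
        have ho := ho.orient
        refine .step _ ?_ fun t hst => ?_
        · rcases Set.eq_empty_or_nonempty (o.orient b).hi with hhi | hhi
          · rcases Set.eq_empty_or_nonempty (o.orient b).lo with hlo | hlo
            · exact ⟨_, .recurse_shift b D F φ k o _ rfl hhi hlo⟩
            · obtain ⟨v, v', he, hopt⟩ := exists_edge_min
                (fun v v' => -(D.w v v' + φ v' - (o.orient b).pot v))
                (h.exists_escape_max hD ho hhi hlo)
              exact ⟨_, .escape_max b D F φ k o _ v v' rfl hhi hlo he fun u u' he' =>
                neg_le_neg_iff.1 (hopt u u' he')⟩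
          · by_cases hex : ∃ v v', EdgeFromTo D ((o.orient b).hi ∩ D.minVerts) F v v'
            · obtain ⟨v, v', he, hopt⟩ := exists_edge_min
                (fun v v' => D.w v v' + φ v' - (o.orient b).pot v) hex
              exact ⟨_, .escape_min b D F φ k o _ v v' rfl hhi he hopt⟩
            · exact ⟨_, .no_escape b D F φ k o _ rfl hhi hex⟩
        · cases hst with
          | escape_min _ _ _ _ _ _ oH v v' hoH hhi he hopt =>
            subst hoH
            exact ih _ (hlt (ho.hi.subset he.2.1.1)) (h.escape_min ho he hopt) rfl
          | no_escape _ _ _ _ _ _ oH hoH hhi hno =>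
            subst hoH
            exact succeeds_attract hD hcalls hk (maxTrap_of_no_escape ho hno) hhi
          | escape_max _ _ _ _ _ _ oH v v' hoH hhi hlo he hopt =>
            subst hoH
            exact ih _ (hlt he.2.1.1) (h.escape_max hD ho hhi he hopt) rfl
          | recurse_shift _ _ _ _ _ _ oH hoH hhi hlo =>
            subst hoH
            have hF : D.verts ⊆ F := by
              have hu := ho.union
              rw [hhi, hlo, Set.union_empty] at hu
              exact Set.sdiff_eq_empty.1 hu.symm
            refine hcalls _ ((hD.reduce φ).orient b)
              (by rw [rank_orient]; exact h.rank_reduce_lt hF hN hNP) _ fun o' ho' => ?_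
            refine .step _ ⟨_, .return_shift b φ k o' _ rfl⟩ fun t hst => ?_
            cases hst with
            | return_shift _ _ _ _ o'' ho'' =>
              subst ho''
              exact hk _ ho'.orient.reduce

theorem succeeds_zones {G : Game V} (hG : G.NoZeroCycle) (hcalls : CallsSucceed post G)
    (hk : ∀ o, Solves G o → Succeeds post (.ret o k)) {U : Set V} (hNU : G.N ⊆ U)
    (hU : U ⊆ G.verts) (hempty : G.N = ∅ → U = ∅) : Succeeds post (.zones G U k) := by
  induction hn : (G.verts \ U).ncard using Nat.strong_induction_on generalizing U with
  | h n ih =>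
    subst hn
    refine .step _ ?_ fun t hst => ?_
    · by_cases hex : ∃ v, ZoneAddable G U v
      · obtain ⟨v, hv⟩ := hex
        exact ⟨_, .zone_add G U k v hv⟩
      · by_cases ht : ReducedTest G U
        · exact ⟨_, .reduced G U k hex ht⟩
        · rcases le_or_gt G.N.ncard G.P.ncard with hle | hlt
          · exact ⟨_, .choose_N G U k hex ht hle⟩
          · exact ⟨_, .choose_P G U k hex ht hlt⟩
    · cases hst with
      | zone_add _ _ _ v hv =>
        have hvU : v ∈ G.verts \ U := ⟨hv.mem_verts, fun h => hv.1 (Or.inr h)⟩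
        refine ih _ (ncard_sdiff_insert_lt G.finite hvU) (hNU.trans (Set.subset_insert _ _))
          (Set.insert_subset hvU.1 hU) (fun hN => ?_) rfl
        rw [hempty hN] at hv
        exact absurd hv (not_zoneAddable_empty hN v)
      | reduced _ _ _ _ ht => exact hk _ (solves_of_reducedTest hU ht)
      | choose_N _ _ _ hex ht hle =>
        refine succeeds_loop (b := false) hG hcalls hk
          (Set.nonempty_iff_ne_empty.2 fun hN => ht ?_) hle (loopInv_N G)
        rw [hempty hN]
        exact reducedTest_empty hN
      | choose_P _ _ _ hex ht hlt =>
        refine succeeds_loop hG.dual ?_ (fun o ho => hk _ ?_) ?_ ?_ (loopInv_N G.dual)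
        · unfold CallsSucceed
          rw [rank_dual]
          exact hcalls
        · rw [← G.dual_dual]; exact ho.dual
        · rw [N_dual]
          exact Set.nonempty_iff_ne_empty.2 fun hP => ht (reducedTest_of_P_eq_empty hG hP hNU hex)
        · rw [N_dual, P_dual]; exact hlt.le

end Machine

theorem succeeds_call {post : Output V → Prop} (G : Game V) (hG : G.NoZeroCycle)
    (k : List (Frame V)) (hk : ∀ o, Solves G o → Succeeds post (.ret o k)) :
    Succeeds post (.call G k) := by
  induction hr : rank G using WellFoundedLT.induction generalizing G k with
  | ind r ih =>
    subst hr
    refine .step _ ⟨_, .start G k⟩ fun t hst => ?_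
    cases hst with
    | start =>
      exact succeeds_zones hG (fun G' hG' hlt k' hk' => ih _ hlt G' hG' k' hk' rfl) hk subset_rfl
        G.N_subset id

end ReduceGame

theorem mainTheorem6 {V : Type*} (G : Game V) (hG : G.NoZeroCycle) :
    -- every execution is finite
    (¬ ∃ s : ℕ → ReduceGame.State V, s 0 = ReduceGame.State.call G [] ∧
      ∀ i, ReduceGame.Step (s i) (s (i + 1))) ∧
    -- no execution gets stuck before it has returned an output
    (∀ s, ReduceGame.Reachable G s →
      (∃ t, ReduceGame.Step s t) ∨ ∃ o, s = ReduceGame.State.ret o []) ∧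
    -- whatever is returned is correct
    (∀ o, ReduceGame.Reachable G (ReduceGame.State.ret o []) →
      G.IsReducingPotential o.pot ∧
      o.lo = (G.reduce o.pot).ZN ∧ o.hi = (G.reduce o.pot).ZP ∧
      G.IsWinningRegions o.lo o.hi) := by
  have h := ReduceGame.succeeds_call G hG [] fun o ho => .done o ho
  refine ⟨h.not_infinite, fun s hs => (h.of_reachable hs).progress, fun o ho => ?_⟩
  have hsol := (h.of_reachable ho).post_of_ret
  exact ⟨hsol.isReducingPotential hG, (hsol.zones hG).1, (hsol.zones hG).2,
    hsol.isWinningRegions hG⟩
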